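/- **Setting.** Fix $d,n\ge 1$, a closed convex set $K\subset\mathbb R^d$ with $\{\|\beta\|_2\le 1\}\subseteq K\subseteq\{\|\beta\|_2\le R_2\}$, and let $h$ be the logistic loss $h(z)=\log(1+e^{-z})$ or the hinge loss $h(z)=\max(0,1-z)$. A fixed (oblivious) sequence of agents $a_t=(x_t,y_t,d_t)$, $t=1,\dots,n$, is given, with $x_t\in\mathbb R^d$, $y_t\in\{-1,1\}$. Facing a classifier $\beta$, a non-strategic agent ($y_t=1$) reports $\hat x_t(\beta)=x_t$; a strategic agent ($y_t=-1$) reports a maximizer $\hat x_t(\beta)$ of $u_t(z,\beta)=\langle\beta,z\rangle-d_t(x_t,z)$ over $z\in\mathbb R^d$, ties being broken arbitrarily. Put $c_t(\beta)=h(y_t\langle\hat x_t(\beta),\beta\rangle)$ and $\theta=\#\{t:y_t=-1\}/n$. The Stackelberg regret of deploying $B=(b_1,\dots,b_n)$ is $\mathcal R_S(A,B)=\sum_t c_t(b_t)-\min_{\beta\in K}\sum_t c_t(\beta)$. **Algorithm**, with parameters $M,L>0$ and $R=R_2$. Let $\delta=\theta^{1/4}\sqrt{\tfrac{dMR}{L(R+3)}}\,n^{-1/4}$,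 $K_\delta=(1-\delta)K$, and $\eta=R\big/\sqrt{n\big(\theta\, d^2M^2/\delta^2+(1-\theta)L^2\big)}$ (the first summand is $0$ if $\theta=0$). Start from an arbitrary $\beta_1\in K_\delta$. In round $t$ draw $S_t$ uniformly from the unit sphere, independently of the past, deploy $\beta_t^+=\beta_t+\delta S_t$ and suffer $c_t(\beta_t^+)$; let $g_t$ be a subgradient of $c_t$ at $\beta_t$ if $y_t=1$ (picked by a measurable rule), and $g_t=\frac d\delta c_t(\beta_t^+)S_t$ if $y_t=-1$; let $\beta_{t+1}$ be the Euclidean projection of $\beta_t-\eta g_t$ onto $K_\delta$. The regret of the algorithm is that of $B=(\beta_1^+,\dots,\beta_n^+)$. **Theorem.** Let $R_1,R_2,\varepsilon>0$, $1<r<\infty$, $\frac1r+\frac1s=1$, and $1\le p,q\le\infty$ with $\frac1p+\frac1q=1$. Assume that $\|x_t\|_2\le R_1$ for all $t$, and that for each strategic agent $d_t(x_t,z)=\frac1r\|A_t(x_t-z)\|_p^r$ with a linear map $A_t:\mathbb R^d\to\mathbb R^d$ whose smallest singular value satisfies $\sigma_d(A_t)\ge\varepsilon$. Let $a=(s/q-s/2)_+$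 (with $s/\infty=0$) and $\kappa=\varepsilon^{-s}d^{a}$, and run the algorithm with $$M=1+R_1R_2+\kappa R_2^s,\qquad L=R_1+s\kappa R_2^{s-1},$$ and with $n$ large enough that $\delta\le1$ (so that all deployed classifiers lie in $K$). The regret is integrable, and its expectation satisfies the following bounds. 1. If $\theta=0$, then $\mathbb E[\mathcal R_S]\le C\,d^{a}\sqrt n$, that is, $O(\sqrt n)$ for each fixed $d$; and $\mathbb E[\mathcal R_S]\le C\sqrt n$ if the algorithm is run with the constants $M=1+R_1R_2$, $L=R_1$ that are valid in the absence of strategic agents. Here $C$ depends only on $R_1,R_2,\varepsilon,r$. 2. If $\theta\ge c>0$, then $\mathbb E[\mathcal R_S]\le C\,n^{3/4}d^{a+1/2}$, with $C$ depending only on $R_1,R_2,\varepsilon,r,c$. 3. If $\theta\le c\,n^{-\gamma}$ with $c>0$, $\gamma\ge0$, and if $\gamma\le1$ or $\theta>0$, then $\mathbb E[\mathcal R_S]\le C\,n^{(3-\gamma)/4}d^{a+1/2}$, with $C$ depending only on $R_1,R_2,\varepsilon,r,c,\gamma$. In particular, for $1\le p\le2$ and every $r>1$, with $M,L$ as displayed,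 the three bounds are $C\sqrt n$, $C\sqrt d\,n^{3/4}$ and $C\sqrt d\,n^{1-(1+\gamma)/4}$, with constants depending on the same quantities. -/

import Mathlib

open scoped ENNReal

namespace StrategicClassification

noncomputable section

/-- Euclidean space `ℝ^d`. -/
abbrev Vec (d : ℕ) := EuclideanSpace ℝ (Fin d)

/-- The `ℓ^p` norm on `ℝ^d`, `1 ≤ p ≤ ∞` (for `p = ∞` the maximum norm). -/
def lpNorm {d : ℕ} (p : ℝ≥0∞) (v : Vec d) : ℝ := ‖WithLp.toLp p v.ofLp‖

/-- The smallest singular value `σ_d` of a linear endomorphism of `ℝ^d`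
(Mathlib lists the singular values in decreasing order, starting from the index `0`). -/
def smallestSingularValue {d : ℕ} (A : Vec d →ₗ[ℝ] Vec d) : ℝ := A.singularValues (d - 1)

/-- An agent: true features `x`, label `y ∈ {-1, 1}` (the units of `ℤ`) and manipulation cost,
`cost x z` being the cost of changing the features from `x` to `z`. -/
structure Agent (d : ℕ) where
  x : Vec d
  y : ℤˣ
  cost : Vec d → Vec d → ℝ

/-- The utility `u(z, β) = ⟨β, z⟩ - cost(x, z)` of reporting `z` to the classifier `β`. -/
def Agent.utility {d : ℕ} (a : Agent d) (z β : Vec d) : ℝ := inner ℝ β z - a.cost a.x z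

/-- `z` is a possible report to `β`: a strategic agent (`y = -1`) sends some maximizer of her
utility, a non-strategic agent (`y = 1`) sends her true features. -/
def Agent.IsResponse {d : ℕ} (a : Agent d) (β z : Vec d) : Prop :=
  (a.y = -1 → ∀ w, a.utility w β ≤ a.utility z β) ∧ (a.y = 1 → z = a.x)

/-- Logistic loss, as a function of the margin. -/
def logistic (z : ℝ) : ℝ := Real.log (1 + Real.exp (-z))

/-- Hinge loss, as a function of the margin. -/
def hinge (z : ℝ) : ℝ := max 0 (1 - z)

/-- `v` is a subgradient of `f : ℝ^d → ℝ` at `β`. -/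
def IsSubgradient {d : ℕ} (f : Vec d → ℝ) (β v : Vec d) : Prop :=
  ∀ β', f β + inner ℝ v (β' - β) ≤ f β'

/-- The Euclidean projection onto a set: a nearest point of the set
(it exists and is unique for the nonempty closed convex sets that occur). -/
def proj {d : ℕ} (K : Set (Vec d)) (z : Vec d) : Vec d :=
  Classical.epsilon fun w => w ∈ K ∧ ∀ v ∈ K, dist z w ≤ dist z v

/-- The unit sphere of `ℝ^d`. -/
abbrev USphere (d : ℕ) := Metric.sphere (0 : Vec d) 1

/-- The uniform distribution on the unit sphere: normalized surface measure. -/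
def uniformSphere (d : ℕ) : MeasureTheory.Measure (USphere d) :=
  ((MeasureTheory.volume : MeasureTheory.Measure (Vec d)).toSphere Set.univ)⁻¹ •
    (MeasureTheory.volume : MeasureTheory.Measure (Vec d)).toSphere

/-- The data of an `n`-round interaction: the feasible set `K`, the margin loss `h`, the
(obliviously chosen) agents, the reports `resp t β` of agent `t` to each classifier `β`, and the rule
`sub` by which the learner picks subgradients in non-strategic rounds. -/
structure Interaction (d n : ℕ) where
  K : Set (Vec d)
  h : ℝ → ℝ
  agent : Fin n → Agent d
  resp : Fin n → Vec d → Vec d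
  sub : Fin n → Vec d → Vec d

namespace Interaction

variable {d n : ℕ} (P : Interaction d n)

/-- The loss `c_t(β) = h(y_t ⟨x̂_t(β), β⟩)`. -/
def loss (t : Fin n) (β : Vec d) : ℝ :=
  P.h ((((P.agent t).y : ℤ) : ℝ) * inner ℝ (P.resp t β) β)

/-- The fraction `θ` of strategic rounds. -/
def theta : ℝ := ((Finset.univ.filter fun t => (P.agent t).y = -1).card : ℝ) / n

/-- The Stackelberg regret of deploying `B 0, …, B (n-1)`. -/
def stackelbergRegret (B : Fin n → Vec d) : ℝ :=
  ∑ t, P.loss t (B t) - sInf ((fun β => ∑ t, P.loss t β) '' P.K)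

/-- The standing assumptions, for agents with costs `(1/r) ‖A_t (x_t - z)‖_p^r`. -/
structure Admissible (R₁ R₂ ε r : ℝ) (p : ℝ≥0∞) : Prop where
  convex : Convex ℝ P.K
  closed : IsClosed P.K
  ball_subset : Metric.closedBall 0 1 ⊆ P.K
  norm_le : ∀ β ∈ P.K, ‖β‖ ≤ R₂
  loss_eq : P.h = logistic ∨ P.h = hinge
  feature_le : ∀ t, ‖(P.agent t).x‖ ≤ R₁
  cost_eq : ∀ t, (P.agent t).y = -1 → ∃ A : Vec d →ₗ[ℝ] Vec d, ε ≤ smallestSingularValue A ∧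
    ∀ z, (P.agent t).cost (P.agent t).x z = 1 / r * lpNorm p (A ((P.agent t).x - z)) ^ r
  response : ∀ t β, (P.agent t).IsResponse β (P.resp t β)
  sub_mem : ∀ t, (P.agent t).y = 1 → ∀ β, IsSubgradient (P.loss t) β (P.sub t β)
  sub_measurable : ∀ t, (P.agent t).y = 1 → Measurable (P.sub t)

/-- The smoothing parameter `δ = θ^{1/4} √(dMR / (L(R+3))) n^{-1/4}`. -/
def delta (M L R : ℝ) : ℝ :=
  P.theta ^ (1 / 4 : ℝ) * √(d * M * R / (L * (R + 3))) * (n : ℝ) ^ (-(1 / 4) : ℝ)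

/-- The step size `η = R / √(n (θ d²M²/δ² + (1-θ) L²))`; the first summand vanishes for `θ = 0`. -/
def eta (M L R : ℝ) : ℝ :=
  R / √(n * (P.theta * (d ^ 2 * M ^ 2 / P.delta M L R ^ 2) + (1 - P.theta) * L ^ 2))

/-- The shrunken feasible set `K_δ = (1 - δ) K`. -/
def shrunken (δ : ℝ) : Set (Vec d) := (fun β => (1 - δ) • β) '' P.K

/-- The stochastic subgradient `g_t` at the iterate `β` for the random direction `u`. -/
def gradEstimate (δ : ℝ) (t : Fin n) (β : Vec d) (u : USphere d) : Vec d :=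
  if (P.agent t).y = 1 then P.sub t β
  else (d / δ * P.loss t (β + δ • (u : Vec d))) • (u : Vec d)

/-- The iterates of the algorithm from the initial point `β₁`, for random directions `S`. -/
def iterate (M L R : ℝ) (β₁ : Vec d) (S : Fin n → USphere d) : Fin (n + 1) → Vec d :=
  Fin.induction β₁ fun t β =>
    proj (P.shrunken (P.delta M L R))
      (β - P.eta M L R • P.gradEstimate (P.delta M L R) t β (S t))

/-- The classifiers `β_t⁺ = β_t + δ S_t` that the algorithm deploys. -/
def deployed (M L R : ℝ) (β₁ : Vec d) (S : Fin n → USphere d) (t : Fin n) : Vec d :=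
  P.iterate M L R β₁ S t.castSucc + P.delta M L R • (S t : Vec d)

/-- For every initial point in `K_δ`, the Stackelberg regret of the algorithm with parameters
`M, L, R` is integrable over the i.i.d. uniform directions, with expectation at most `b`. -/
def ExpectedRegretLE (M L R b : ℝ) : Prop :=
  ∀ β₁ ∈ P.shrunken (P.delta M L R),
    MeasureTheory.Integrable (fun S => P.stackelbergRegret (P.deployed M L R β₁ S))
      (MeasureTheory.Measure.pi fun _ => uniformSphere d) ∧
    ∫ S, P.stackelbergRegret (P.deployed M L R β₁ S)
      ∂(MeasureTheory.Measure.pi fun _ => uniformSphere d) ≤ b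

end Interaction

/-- The exponent `(s/q - s/2)_+`, where `s/q = 0` for `q = ∞`. -/
def dimExponent (s : ℝ) (q : ℝ≥0∞) : ℝ := max (s * (q⁻¹).toReal - s / 2) 0

/-- The factor `ε^{-s} d^{(s/q - s/2)_+}`. -/
def costFactor (ε s : ℝ) (q : ℝ≥0∞) (d : ℕ) : ℝ := ε ^ (-s) * (d : ℝ) ^ dimExponent s q

/-- The loss bound `M = 1 + R₁R₂ + κ R₂^s`. -/
def lossBound (R₁ R₂ s κ : ℝ) : ℝ := 1 + R₁ * R₂ + κ * R₂ ^ s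

/-- The Lipschitz constant `L = R₁ + s κ R₂^{s-1}` of the losses. -/
def lossLip (R₁ R₂ s κ : ℝ) : ℝ := R₁ + s * κ * R₂ ^ (s - 1)

end

end StrategicClassification

/-! Strategic behaviour does not destroy convexity. Let `z` be any best response to `β` and `N = ‖A
(x - z)‖_p`. Stationarity of the utility along the ray from `x` through `z` gives `⟨β, z - x⟩ = N ^
r` (`inner_response_sub`), so the optimal utility is `⟨β, x⟩ + N ^ r / s`, and the margin `⟨z, β⟩`
is `⟨β, x⟩` plus `s` times the excess of the optimal utility over `⟨β, x⟩`. The optimal utility is a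
supremum of affine functions of `β`; hence the margin is convex, with subgradient `x + s (z - x)`
(`margin_subgradient`), and so is the loss, `h` being convex and nonincreasing. The same identity,
Cauchy–Schwarz and the comparison of norms bound the displacement `‖z - x‖` by `κ ‖β‖ ^ (s - 1)`
(`norm_response_sub_le`), which is where `M` and `L` come from. Ties are harmless, since all of this
holds for every maximizer.

What remains is bandit convex optimization for losses that are convex, bounded by `M` and
`L`-Lipschitz on `K` (`Interaction.Regular`). In a strategic round the estimate `(d / δ) c(β + δS)
S` is in expectation a subgradient up to an error of order `Lδ`. The proof of this
(`spherical_gradient_le`) uses neither smoothing nor the divergence theorem: a difference quotient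
is moved between the loss and a radial Lipschitz cutoff of the ball of radius `δ`, whose derivative
lives on a thin annulus, and the annulus then shrinks to the sphere.

Projected gradient descent bounds the linearized regret on every path by `5/2 R √Q`, where `Q`
(`gradBudget`) bounds the sum of the squared gradient norms. Passing to true losses costs `3Lδ` per
round in expectation, because the iterate does not depend on the current direction; replacing the
comparator `β` by `(1 - δ) β` costs `RLδ`. The chosen `δ` makes `(R + 3) n L δ` equal to the bandit
part of `R √Q`, both being `θ^{1/4} n^{3/4} √(d M L R (R + 3))` (`regret_rate_le`). Since `M` and
`L` grow at most like `d ^ a`, the rates follow. -/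

namespace StrategicClassification

open MeasureTheory Metric Set Filter Topology

/-! ### The one-point gradient estimate on the sphere -/

section SphericalGradient

variable {d : ℕ}

lemma toSphere_univ_ne_zero (hd : 0 < d) :
    (volume : Measure (Vec d)).toSphere univ ≠ 0 := by
  have : Nonempty (Fin d) := ⟨⟨0, hd⟩⟩
  rw [Ne, Measure.measure_univ_eq_zero]
  exact Measure.toSphere_ne_zero _

lemma isProbabilityMeasure_uniformSphere (hd : 0 < d) :
    IsProbabilityMeasure (uniformSphere d) := by
  constructor
  rw [uniformSphere, Measure.smul_apply, smul_eq_mul]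
  exact ENNReal.inv_mul_cancel (toSphere_univ_ne_zero hd) (measure_ne_top _ _)

lemma integral_toSphere_eq (hd : 0 < d) (G : USphere d → ℝ) :
    ∫ x, G x ∂(volume : Measure (Vec d)).toSphere
      = (volume : Measure (Vec d)).toSphere.real univ * ∫ x, G x ∂(uniformSphere d) := by
  rw [uniformSphere, integral_smul_measure, smul_eq_mul, ← mul_assoc, ENNReal.toReal_inv,
    Measure.real, mul_inv_cancel₀, one_mul]
  exact (ENNReal.toReal_pos (toSphere_univ_ne_zero hd) (measure_ne_top _ _)).ne'

/-- Polar coordinates split the integral into a product. The radial factor `I` is common to all `G`,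
so it never has to be computed: taking `G = 1` eliminates it. The condition `ψ 0 = 0` disposes of
the origin, which polar coordinates omit. -/
lemma integral_direction_mul_norm (ψ : ℝ → ℝ) (hψ : ψ 0 = 0) :
    ∃ I : ℝ, ∀ G : Vec d → ℝ, ∫ x : Vec d, G (‖x‖⁻¹ • x) * ψ ‖x‖
      = (∫ x : USphere d, G x ∂(volume : Measure (Vec d)).toSphere) * I := by
  let μ : Measure (Vec d) := volume
  refine ⟨∫ y : Ioi (0 : ℝ), ψ y ∂Measure.volumeIoiPow (Module.finrank ℝ (Vec d) - 1), fun G => ?_⟩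
  calc
    ∫ x : Vec d, G (‖x‖⁻¹ • x) * ψ ‖x‖
      = ∫ x in ({0}ᶜ : Set (Vec d)), G (‖x‖⁻¹ • x) * ψ ‖x‖ := by
        symm
        apply setIntegral_eq_integral_of_forall_compl_eq_zero
        intro x hx
        have : x = 0 := by simpa using hx
        simp [this, hψ]
    _ = ∫ x : ({(0)}ᶜ : Set (Vec d)), G (‖x.1‖⁻¹ • x.1) * ψ ‖x.1‖ ∂(μ.comap (↑)) := by
      rw [integral_subtype_comap (measurableSet_singleton _).compl
        fun x : Vec d ↦ G (‖x‖⁻¹ • x) * ψ ‖x‖]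
    _ = ∫ x, G x.1 * ψ x.2 ∂μ.toSphere.prod (.volumeIoiPow (Module.finrank ℝ (Vec d) - 1)) := by
      simpa using μ.measurePreserving_homeomorphUnitSphereProd.integral_comp
        (Homeomorph.measurableEmbedding _)
        (fun p : sphere (0 : Vec d) 1 × Ioi (0 : ℝ) => G p.1 * ψ p.2)
    _ = _ := integral_prod_mul (fun x : USphere d => G x) fun y : Ioi (0 : ℝ) => ψ y

/-- Polar coordinates on an annulus. -/
lemma setIntegral_annulus_direction (hd : 0 < d) {a b : ℝ} (ha : 0 ≤ a) (G : Vec d → ℝ) :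
    ∫ x in {x : Vec d | a < ‖x‖ ∧ ‖x‖ < b}, G (‖x‖⁻¹ • x)
      = volume.real {x : Vec d | a < ‖x‖ ∧ ‖x‖ < b} * ∫ x : USphere d, G x ∂uniformSphere d := by
  have hms : MeasurableSet {x : Vec d | a < ‖x‖ ∧ ‖x‖ < b} :=
    ((isOpen_lt continuous_const continuous_norm).inter
      (isOpen_lt continuous_norm continuous_const)).measurableSet
  obtain ⟨I, hI⟩ := integral_direction_mul_norm (d := d) ((Ioo a b).indicator 1)
    (by simp [ha])
  have key : ∀ G : Vec d → ℝ, ∫ x in {x : Vec d | a < ‖x‖ ∧ ‖x‖ < b}, G (‖x‖⁻¹ • x)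
      = (∫ x : USphere d, G x ∂(volume : Measure (Vec d)).toSphere) * I := by
    intro G
    rw [← hI, ← integral_indicator hms]
    congr 1 with x
    by_cases hx : a < ‖x‖ ∧ ‖x‖ < b
    · rw [indicator_of_mem (by exact hx), indicator_of_mem (by exact hx)]; simp
    · rw [indicator_of_notMem (by exact hx), indicator_of_notMem (by exact hx)]; simp
  have h1 := key fun _ => 1
  simp only [integral_const, smul_eq_mul, mul_one, MeasurableSet.univ, measureReal_restrict_apply,
    univ_inter] at h1
  rw [key, h1, integral_toSphere_eq hd]
  ring

/-- The piecewise linear radial cutoff, `1` for `‖x‖ ≤ δ - h` and `0` for `‖x‖ ≥ δ`. -/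
noncomputable def radialCutoff (δ h : ℝ) (x : Vec d) : ℝ := max 0 (min 1 (h⁻¹ * (δ - ‖x‖)))

lemma radialCutoff_nonneg (δ h : ℝ) (x : Vec d) : 0 ≤ radialCutoff δ h x := le_max_left _ _

lemma radialCutoff_le_one (δ h : ℝ) (x : Vec d) : radialCutoff δ h x ≤ 1 :=
  max_le zero_le_one (min_le_left _ _)

lemma radialCutoff_eq_zero {δ h : ℝ} (hh : 0 < h) {x : Vec d} (hx : δ ≤ ‖x‖) :
    radialCutoff δ h x = 0 := by
  refine max_eq_left ((min_le_right _ _).trans ?_)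
  exact mul_nonpos_of_nonneg_of_nonpos (by positivity) (by linarith)

lemma radialCutoff_eq_one {δ h : ℝ} (hh : 0 < h) {x : Vec d} (hx : ‖x‖ ≤ δ - h) :
    radialCutoff δ h x = 1 := by
  have : 1 ≤ h⁻¹ * (δ - ‖x‖) := by
    rw [← inv_mul_cancel₀ hh.ne']; gcongr; linarith
  rw [radialCutoff, min_eq_left this, max_eq_right zero_le_one]

lemma radialCutoff_eq_mid {δ h : ℝ} (hh : 0 < h) {x : Vec d} (h1 : δ - h ≤ ‖x‖) (h2 : ‖x‖ ≤ δ) :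
    radialCutoff δ h x = h⁻¹ * (δ - ‖x‖) := by
  have : h⁻¹ * (δ - ‖x‖) ≤ 1 := by
    rw [← inv_mul_cancel₀ hh.ne']; gcongr; linarith
  rw [radialCutoff, min_eq_right this, max_eq_right]
  exact mul_nonneg (by positivity) (by linarith)

lemma lipschitzWith_radialCutoff (δ : ℝ) {h : ℝ} (hh : 0 < h) :
    LipschitzWith (Real.toNNReal h⁻¹) (radialCutoff (d := d) δ h) := by
  have h1 : LipschitzWith (Real.toNNReal h⁻¹) fun x : Vec d => h⁻¹ * (δ - ‖x‖) := by
    refine LipschitzWith.of_dist_le_mul fun x y => ?_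
    rw [Real.dist_eq, ← mul_sub, abs_mul, abs_of_pos (by positivity : 0 < h⁻¹),
      Real.coe_toNNReal _ (by positivity), dist_eq_norm]
    gcongr
    rw [sub_sub_sub_cancel_left, norm_sub_rev]
    exact abs_norm_sub_norm_le y x
  exact (h1.const_min 1).const_max 0

lemma hasCompactSupport_radialCutoff (δ : ℝ) {h : ℝ} (hh : 0 < h) :
    HasCompactSupport (radialCutoff (d := d) δ h) := by
  refine HasCompactSupport.intro (isCompact_closedBall 0 δ) fun x hx => ?_
  refine radialCutoff_eq_zero hh ?_
  simp only [mem_closedBall, dist_zero_right, not_le] at hx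
  exact hx.le

/-- The excluded radii are the kinks of the cutoff; the two spheres are null sets and do not affect
integrals. -/
lemma lineDeriv_radialCutoff {δ h : ℝ} (hδ : h < δ) (hh : 0 < h) (v x : Vec d)
    (h1 : ‖x‖ ≠ δ - h) (h2 : ‖x‖ ≠ δ) :
    lineDeriv ℝ (radialCutoff δ h) x v =
      {x : Vec d | δ - h < ‖x‖ ∧ ‖x‖ < δ}.indicator
        (fun x => h⁻¹ * - inner ℝ (‖x‖⁻¹ • x) v) x := by
  have hcont : Continuous fun y : Vec d => ‖y‖ := continuous_norm
  rcases lt_or_gt_of_ne h1 with h1 | h1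
  · rw [indicator_of_notMem (by simp only [mem_ofPred_eq]; intro h; linarith [h.1])]
    have : radialCutoff δ h =ᶠ[𝓝 x] fun _ => 1 := by
      filter_upwards [hcont.continuousAt.eventually_lt continuousAt_const h1] with y hy
      exact radialCutoff_eq_one hh hy.le
    rw [this.lineDeriv_eq]; simp [lineDeriv]
  rcases lt_or_gt_of_ne h2 with h2 | h2
  · rw [indicator_of_mem (by exact ⟨h1, h2⟩)]
    have : radialCutoff δ h =ᶠ[𝓝 x] fun y => h⁻¹ * (δ - ‖y‖) := by
      filter_upwards [hcont.continuousAt.eventually_lt continuousAt_const h2,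
        continuousAt_const.eventually_lt hcont.continuousAt h1] with y hy hy'
      exact radialCutoff_eq_mid hh hy'.le hy.le
    rw [this.lineDeriv_eq]
    have hx : 0 < ‖x‖ := by linarith
    have hd : HasDerivAt (fun t : ℝ => x + t • v) v 0 := by
      simpa using ((hasDerivAt_id (0 : ℝ)).smul_const v).const_add x
    have hd2 := hd.norm_sq.sqrt (by simp [hx.ne'])
    simp only [zero_smul, add_zero, Real.sqrt_sq (norm_nonneg _)] at hd2
    have hd3 := (hd2.const_sub δ).const_mul h⁻¹
    rw [lineDeriv, hd3.deriv, real_inner_smul_left]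
    field_simp
  · rw [indicator_of_notMem (by simp only [mem_ofPred_eq]; intro h; linarith [h.2])]
    have : radialCutoff δ h =ᶠ[𝓝 x] fun _ => 0 := by
      filter_upwards [continuousAt_const.eventually_lt hcont.continuousAt h2] with y hy
      exact radialCutoff_eq_zero hh (le_of_lt hy)
    rw [this.lineDeriv_eq]; simp [lineDeriv]

lemma integrable_radialCutoff_mul (δ : ℝ) {h : ℝ} (hh : 0 < h) {F : Vec d → ℝ}
    (hF : Continuous F) : Integrable fun x => radialCutoff δ h x * F x :=
  ((lipschitzWith_radialCutoff δ hh).continuous.mul hF).integrable_of_hasCompactSupport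
    (hasCompactSupport_radialCutoff δ hh).mul_right

/-- Integration by parts in discrete form: translation moves the difference quotient from the cutoff
to `F`, where convexity bounds it by the full increment `F (x + w) - F x`. Thus `F` need not be
differentiable. -/
lemma integral_lineDeriv_radialCutoff_le {δ h : ℝ} (hh : 0 < h) {F : Vec d → ℝ}
    (hconv : ConvexOn ℝ univ F) (hF : Continuous F) (w : Vec d) {C : ℝ}
    (hC : ∀ u ∈ closedBall (0 : Vec d) δ, F (u + w) - F u ≤ C) :
    ∫ x, lineDeriv ℝ (radialCutoff δ h) x (-w) * F x ≤ C * ∫ x : Vec d, radialCutoff δ h x := by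
  refine le_of_tendsto ((lipschitzWith_radialCutoff δ
    hh).integral_inv_smul_sub_mul_tendsto_integral_lineDeriv_mul'
    (hasCompactSupport_radialCutoff δ hh) (μ := volume) hF (-w)) ?_
  filter_upwards [Ioc_mem_nhdsGT (zero_lt_one' ℝ)] with t ht
  have hFt : Continuous fun x => F (x + t • w) := by fun_prop
  have hshift : ∫ x, radialCutoff δ h (x + t • -w) * F x
      = ∫ x, radialCutoff δ h x * F (x + t • w) := by
    rw [← integral_add_right_eq_self _ (t • w)]
    simp
  have hint : Integrable fun x => radialCutoff δ h (x + t • -w) * F x := by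
    have := (integrable_radialCutoff_mul δ hh hFt).comp_add_right (t • -w)
    simpa using this
  have e1 : ∫ x, (t⁻¹ • (radialCutoff δ h (x + t • -w) - radialCutoff δ h x)) * F x
      = ∫ x, t⁻¹ * (radialCutoff δ h x * F (x + t • w) - radialCutoff δ h x * F x) := by
    rw [integral_const_mul, integral_sub (integrable_radialCutoff_mul δ hh hFt)
      (integrable_radialCutoff_mul δ hh hF), ← hshift, ← integral_sub hint
      (integrable_radialCutoff_mul δ hh hF), ← integral_const_mul]
    congr 1 with x
    rw [smul_eq_mul]; ring
  rw [e1, ← integral_const_mul]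
  refine integral_mono (((integrable_radialCutoff_mul δ hh hFt).sub
    (integrable_radialCutoff_mul δ hh hF)).const_mul _) ?_ fun x => ?_
  · simpa [mul_comm] using integrable_radialCutoff_mul (d := d) δ hh (continuous_const (y := C))
  · change t⁻¹ * (radialCutoff δ h x * F (x + t • w) - radialCutoff δ h x * F x)
      ≤ C * radialCutoff δ h x
    by_cases hx : ‖x‖ ≤ δ
    · have h1 := hC x (by simpa using hx)
      -- Difference quotients of a convex function increase with the step, and `t ≤ 1`.
      have h2 : F (x + t • w) ≤ (1 - t) * F x + t * F (x + w) := by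
        have := hconv.2 (mem_univ x) (mem_univ (x + w)) (sub_nonneg.2 ht.2) ht.1.le (by ring)
        rwa [show (1 - t) • x + t • (x + w) = x + t • w by module, smul_eq_mul, smul_eq_mul] at this
      have h3 : t⁻¹ * (F (x + t • w) - F x) ≤ C := by
        rw [inv_mul_le_iff₀ ht.1]
        nlinarith [ht.1, mul_le_mul_of_nonneg_left h1 ht.1.le]
      calc _ = (t⁻¹ * (F (x + t • w) - F x)) * radialCutoff δ h x := by ring
        _ ≤ _ := by gcongr; exact radialCutoff_nonneg _ _ _
    · rw [radialCutoff_eq_zero hh (not_le.1 hx).le]; simp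

lemma volume_real_annulus (hd : 0 < d) {a b : ℝ} (ha : 0 ≤ a) (hab : a ≤ b) :
    volume.real {x : Vec d | a < ‖x‖ ∧ ‖x‖ < b}
      = (b ^ d - a ^ d) * volume.real (ball (0 : Vec d) 1) := by
  have : Nonempty (Fin d) := ⟨⟨0, hd⟩⟩
  have : {x : Vec d | a < ‖x‖ ∧ ‖x‖ < b} = ball 0 b \ closedBall 0 a := by
    ext x; simp [and_comm]
  rw [this]
  have hball : ∀ c : ℝ, 0 ≤ c → volume.real (ball (0 : Vec d) c)
      = c ^ d * volume.real (ball (0 : Vec d) 1) := fun c hc => by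
    rw [← Measure.addHaar_real_closedBall_eq_addHaar_real_ball,
      Measure.addHaar_real_closedBall _ _ hc, finrank_euclideanSpace_fin]
  have hcb : volume.real (closedBall (0 : Vec d) a)
      = a ^ d * volume.real (ball (0 : Vec d) 1) := by
    rw [Measure.addHaar_real_closedBall _ _ ha, finrank_euclideanSpace_fin]
  rcases hab.eq_or_lt with rfl | hlt
  · rw [sdiff_eq_empty.2 ball_subset_closedBall]; simp
  · rw [measureReal_sdiff (closedBall_subset_ball hlt) isClosed_closedBall.measurableSet,
      hball _ (ha.trans hab), hcb]
    ring

/-- The cutoff lies between the indicators of the balls of radii `δ - h` and `δ`. -/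
lemma abs_integral_radialCutoff_sub_le (hd : 0 < d) {δ h : ℝ} (hδ : h < δ) (hh : 0 < h) :
    |(∫ x : Vec d, radialCutoff δ h x) - δ ^ d * volume.real (ball (0 : Vec d) 1)|
      ≤ (δ ^ d - (δ - h) ^ d) * volume.real (ball (0 : Vec d) 1) := by
  have : Nonempty (Fin d) := ⟨⟨0, hd⟩⟩
  have hcb : ∀ c : ℝ, 0 ≤ c → volume.real (closedBall (0 : Vec d) c)
      = c ^ d * volume.real (ball (0 : Vec d) 1) := fun c hc => by
    rw [Measure.addHaar_real_closedBall _ _ hc, finrank_euclideanSpace_fin]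
  have hint : Integrable fun x : Vec d => radialCutoff δ h x := by
    simpa using integrable_radialCutoff_mul (d := d) δ hh (continuous_const (y := 1))
  have hind : ∀ c : ℝ, Integrable ((closedBall (0 : Vec d) c).indicator (1 : Vec d → ℝ)) :=
    fun c => (integrable_indicator_iff isClosed_closedBall.measurableSet).2
      ((integrableOn_const measure_closedBall_lt_top.ne : IntegrableOn (fun _ : Vec d => (1 : ℝ)) _ _))
  have h1 : (δ - h) ^ d * volume.real (ball (0 : Vec d) 1) ≤ ∫ x : Vec d, radialCutoff δ h x := by
    rw [← hcb _ (by linarith), ← integral_indicator_one isClosed_closedBall.measurableSet]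
    refine integral_mono (hind _) hint fun x => ?_
    by_cases hx : x ∈ closedBall (0 : Vec d) (δ - h)
    · rw [indicator_of_mem hx, radialCutoff_eq_one hh (by simpa using hx)]; rfl
    · rw [indicator_of_notMem hx]; exact radialCutoff_nonneg _ _ _
  have h2 : ∫ x : Vec d, radialCutoff δ h x ≤ δ ^ d * volume.real (ball (0 : Vec d) 1) := by
    rw [← hcb _ (by linarith), ← integral_indicator_one isClosed_closedBall.measurableSet]
    refine integral_mono hint (hind _) fun x => ?_
    by_cases hx : x ∈ closedBall (0 : Vec d) δ
    · rw [indicator_of_mem hx]; exact radialCutoff_le_one _ _ _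
    · rw [indicator_of_notMem hx, radialCutoff_eq_zero hh]
      simp only [mem_closedBall, dist_zero_right, not_le] at hx
      exact hx.le
  rw [abs_le]
  constructor <;> linarith

/-- The cutoff inequality at positive width `h`, with the common factor `volume (ball 0 1)`
cancelled. The errors are `h |L| ‖w‖`, from replacing `F` on the annulus by its value on the sphere
of radius `δ`, and the `|C|` term, from replacing the cutoff by the ball. -/
lemma annulus_average_le (hd : 0 < d) {δ h : ℝ} (hδ : h < δ) (hh : 0 < h) {F : Vec d → ℝ}
    (hconv : ConvexOn ℝ univ F) (hF : Continuous F) (w : Vec d) {C L : ℝ}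
    (hC : ∀ u ∈ closedBall (0 : Vec d) δ, F (u + w) - F u ≤ C)
    (hL : ∀ u ∈ closedBall (0 : Vec d) δ, ∀ v ∈ closedBall (0 : Vec d) δ,
      |F u - F v| ≤ L * ‖u - v‖) :
    h⁻¹ * (δ ^ d - (δ - h) ^ d) *
        (∫ x : USphere d, F (δ • (x : Vec d)) * inner ℝ (x : Vec d) w ∂uniformSphere d
          - h * (|L| * ‖w‖))
      ≤ C * δ ^ d + |C| * (δ ^ d - (δ - h) ^ d) := by
  have : Nonempty (Fin d) := ⟨⟨0, hd⟩⟩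
  set V := volume.real (ball (0 : Vec d) 1) with hV
  have hVpos : 0 < V := ENNReal.toReal_pos (measure_ball_pos _ _ one_pos).ne'
    measure_ball_lt_top.ne
  set A := {x : Vec d | δ - h < ‖x‖ ∧ ‖x‖ < δ} with hA
  have hAm : MeasurableSet A :=
    ((isOpen_lt continuous_const continuous_norm).inter
      (isOpen_lt continuous_norm continuous_const)).measurableSet
  have hAfin : volume A ≠ ⊤ :=
    ((measure_mono fun x hx => by simpa using hx.2.le).trans_lt
      (measure_closedBall_lt_top (x := (0 : Vec d)) (r := δ))).ne
  have hAvol : volume.real A = (δ ^ d - (δ - h) ^ d) * V :=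
    volume_real_annulus hd (by linarith) (by linarith)
  have hpow : 0 ≤ δ ^ d - (δ - h) ^ d := by
    have := pow_le_pow_left₀ (by linarith : 0 ≤ δ - h) (by linarith : δ - h ≤ δ) d
    linarith
  have hnull : ∀ c : ℝ, c ≠ 0 → ∀ᵐ x : Vec d, ‖x‖ ≠ c := fun c hc => by
    have := Measure.addHaar_sphere_of_ne_zero volume (0 : Vec d) hc
    filter_upwards [compl_mem_ae_iff.2 this] with x hx
    simpa using hx
  have hkey := integral_lineDeriv_radialCutoff_le hh hconv hF w hC
  have e1 : ∫ x, lineDeriv ℝ (radialCutoff δ h) x (-w) * F x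
      = ∫ x in A, h⁻¹ * (F x * inner ℝ (‖x‖⁻¹ • x) w) := by
    rw [← integral_indicator hAm]
    refine integral_congr_ae ?_
    filter_upwards [hnull (δ - h) (by linarith), hnull δ (by linarith)] with x h1 h2
    rw [lineDeriv_radialCutoff hδ hh _ _ h1 h2]
    by_cases hx : x ∈ A
    · rw [indicator_of_mem hx, indicator_of_mem hx, inner_neg_right]; ring
    · rw [indicator_of_notMem hx, indicator_of_notMem hx, zero_mul]
  have e2 : ∫ x in A, F (δ • ‖x‖⁻¹ • x) * inner ℝ (‖x‖⁻¹ • x) w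
      = volume.real A *
        ∫ x : USphere d, F (δ • (x : Vec d)) * inner ℝ (x : Vec d) w ∂uniformSphere d :=
    setIntegral_annulus_direction hd (by linarith) fun y => F (δ • y) * inner ℝ y w
  have hdir : Measurable fun x : Vec d => ‖x‖⁻¹ • x := by fun_prop
  have hbdd : ∀ y : Vec d, ‖‖y‖⁻¹ • y‖ ≤ 1 := fun y => by
    rw [norm_smul, norm_inv, norm_norm]; exact inv_mul_le_one
  obtain ⟨B, hB⟩ := (isCompact_closedBall (0 : Vec d) δ).exists_bound_of_continuousOn
    hF.continuousOn
  have hintgen : ∀ g : Vec d → Vec d, Measurable g → (∀ x ∈ A, ‖g x‖ ≤ δ) →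
      IntegrableOn (fun x => F (g x) * inner ℝ (‖x‖⁻¹ • x) w) A := fun g hg hgA => by
    refine Measure.integrableOn_of_bounded (M := B * ‖w‖) hAfin
      ((hF.measurable.comp hg).mul (hdir.inner_const)).aestronglyMeasurable ?_
    filter_upwards [ae_restrict_mem hAm] with x hx
    rw [norm_mul]
    have h1 := hB (g x) (by simpa using hgA x hx)
    have h2 : ‖inner ℝ (‖x‖⁻¹ • x) w‖ ≤ ‖w‖ :=
      (norm_inner_le_norm _ _).trans (mul_le_of_le_one_left (norm_nonneg _) (hbdd x))
    exact mul_le_mul h1 h2 (norm_nonneg _) ((norm_nonneg _).trans h1)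
  have hδdir : ∀ x : Vec d, ‖δ • ‖x‖⁻¹ • x‖ ≤ δ := fun x => by
    rw [norm_smul, Real.norm_of_nonneg (by linarith)]
    exact mul_le_of_le_one_right (by linarith) (hbdd x)
  have e3 : volume.real A *
        (∫ x : USphere d, F (δ • (x : Vec d)) * inner ℝ (x : Vec d) w ∂uniformSphere d
          - h * (|L| * ‖w‖)) ≤ ∫ x in A, F x * inner ℝ (‖x‖⁻¹ • x) w := by
    have hc : IntegrableOn (fun _ : Vec d => h * (|L| * ‖w‖)) A := integrableOn_const hAfin
    rw [mul_sub, ← e2, ← smul_eq_mul _ (h * (|L| * ‖w‖)), ← setIntegral_const,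
      ← integral_sub (hintgen (fun x => δ • ‖x‖⁻¹ • x) (hdir.const_smul δ) fun x _ => hδdir x) hc]
    refine setIntegral_mono_on ((hintgen (fun x => δ • ‖x‖⁻¹ • x) (hdir.const_smul δ)
      fun x _ => hδdir x).sub hc) (hintgen id measurable_id fun x hx => hx.2.le) hAm fun x hx => ?_
    have hx0 : 0 < ‖x‖ := by linarith [hx.1]
    have h1 := hL _ (by simpa using hδdir x) x (by simpa using hx.2.le)
    -- Radial projection to the sphere moves a point of the annulus by at most its width.
    have h2 : ‖δ • ‖x‖⁻¹ • x - x‖ ≤ h := by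
      have : δ • ‖x‖⁻¹ • x - x = (δ - ‖x‖) • ‖x‖⁻¹ • x := by
        rw [sub_smul, smul_inv_smul₀ hx0.ne']
      rw [this, norm_smul, Real.norm_of_nonneg (by linarith [hx.2])]
      calc _ ≤ (δ - ‖x‖) * 1 := by gcongr; linarith [hx.2]; exact hbdd x
        _ ≤ h := by linarith [hx.1]
    have h3 : |inner ℝ (‖x‖⁻¹ • x) w| ≤ ‖w‖ :=
      (norm_inner_le_norm (𝕜 := ℝ) _ _).trans (mul_le_of_le_one_left (norm_nonneg _) (hbdd x))
    have h4 : |(F (δ • ‖x‖⁻¹ • x) - F x) * inner ℝ (‖x‖⁻¹ • x) w| ≤ h * (|L| * ‖w‖) := by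
      rw [abs_mul]
      calc _ ≤ (|L| * h) * ‖w‖ := by
            gcongr
            exact h1.trans (mul_le_mul (le_abs_self _) h2 (norm_nonneg _) (abs_nonneg _))
        _ = _ := by ring
    have := (abs_le.1 h4).2
    linarith
  have e4 := abs_le.1 (abs_integral_radialCutoff_sub_le hd hδ hh)
  rw [e1, integral_const_mul] at hkey
  have e5 : C * ∫ x : Vec d, radialCutoff δ h x
      ≤ (C * δ ^ d + |C| * (δ ^ d - (δ - h) ^ d)) * V := by
    have : C * ((∫ x : Vec d, radialCutoff δ h x) - δ ^ d * V)
        ≤ |C| * ((δ ^ d - (δ - h) ^ d) * V) := by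
      refine (le_abs_self _).trans ?_
      rw [abs_mul]
      gcongr
      exact abs_integral_radialCutoff_sub_le hd hδ hh
    linarith
  rw [hAvol] at e3
  have e6 := (mul_le_mul_of_nonneg_left e3 (inv_nonneg.2 hh.le)).trans (hkey.trans e5)
  refine le_of_mul_le_mul_right ?_ hVpos
  calc _ = _ := ?_
    _ ≤ _ := e6
  ring

/-- The spherical one-point gradient estimate of a convex function is an approximate subgradient:
it is bounded by any bound for the increments over the ball. -/
theorem spherical_gradient_le (hd : 0 < d) {δ : ℝ} (hδ : 0 < δ) {F : Vec d → ℝ}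
    (hconv : ConvexOn ℝ univ F) (hF : Continuous F) (w : Vec d) {C L : ℝ}
    (hC : ∀ u ∈ closedBall (0 : Vec d) δ, F (u + w) - F u ≤ C)
    (hL : ∀ u ∈ closedBall (0 : Vec d) δ, ∀ v ∈ closedBall (0 : Vec d) δ,
      |F u - F v| ≤ L * ‖u - v‖) :
    d / δ * ∫ x : USphere d, F (δ • (x : Vec d)) * inner ℝ (x : Vec d) w ∂uniformSphere d
      ≤ C := by
  set I := ∫ x : USphere d, F (δ • (x : Vec d)) * inner ℝ (x : Vec d) w ∂uniformSphere d
  have hder : HasDerivAt (fun h : ℝ => δ ^ d - (δ - h) ^ d) (d * δ ^ (d - 1)) 0 := by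
    have := (((hasDerivAt_id (0 : ℝ)).const_sub δ).pow d).const_sub (δ ^ d)
    simpa using this
  have hslope := hder.tendsto_slope_zero_right
  simp only [zero_add, sub_zero, sub_self, smul_eq_mul] at hslope
  have hid : Tendsto (fun h : ℝ => h) (𝓝[>] 0) (𝓝 0) := tendsto_id.mono_left nhdsWithin_le_nhds
  have h0 : Tendsto (fun h : ℝ => δ ^ d - (δ - h) ^ d) (𝓝[>] 0) (𝓝 0) := by
    have := hder.continuousAt.tendsto.mono_left (nhdsWithin_le_nhds (s := Ioi 0))
    simpa using this
  -- As the width tends to `0`, the annulus factor tends to `d δ ^ (d - 1)` and all errors vanish;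
  -- dividing by `δ ^ d` leaves the factor `d / δ`.
  have hlim1 := hslope.mul ((hid.mul_const (|L| * ‖w‖)).const_sub I)
  have hlim2 := (h0.const_mul |C|).const_add (C * δ ^ d)
  have hle := le_of_tendsto_of_tendsto hlim1 hlim2 (by
    filter_upwards [Ioo_mem_nhdsGT hδ] with h hh
    exact annulus_average_le hd hh.2 hh.1 hconv hF w hC hL)
  simp only [zero_mul, sub_zero, mul_zero, add_zero] at hle
  have hpos : 0 < δ ^ d := pow_pos hδ d
  refine le_of_mul_le_mul_right ?_ hpos
  refine le_trans (le_of_eq ?_) hle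
  obtain ⟨k, rfl⟩ := Nat.exists_eq_add_of_lt hd
  simp only [zero_add, Nat.add_sub_cancel, pow_succ]
  field_simp

end SphericalGradient

/-! ### Supporting lines of the logistic and hinge losses -/

section MarginLosses

/-- With `l = -logistic' x` one has `1 + e^{-y} = (1 + e^{-x}) ((1 - l) + l e^{x-y})`. Convexity of
`exp` bounds the last factor below by `e^{l(x-y)}`; then take logarithms. -/
lemma exists_slope_logistic (x : ℝ) :
    ∃ l : ℝ, 0 ≤ l ∧ l ≤ 1 ∧ ∀ y, logistic x - l * (y - x) ≤ logistic y := by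
  have hpos : ∀ z : ℝ, 0 < 1 + Real.exp z := fun z => by positivity
  set l := Real.exp (-x) / (1 + Real.exp (-x)) with hl
  have hl0 : 0 ≤ l := by positivity
  have hl1 : l ≤ 1 := by rw [hl, div_le_one (hpos _)]; linarith
  refine ⟨l, hl0, hl1, fun y => ?_⟩
  have h1 := convexOn_exp.2 (mem_univ 0) (mem_univ (x - y)) (sub_nonneg.2 hl1) hl0 (by ring)
  simp only [smul_eq_mul, mul_zero, zero_add, Real.exp_zero, mul_one] at h1
  have h2 : (1 - l + l * Real.exp (x - y)) * (1 + Real.exp (-x)) = 1 + Real.exp (-y) := by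
    have : Real.exp (-y) = Real.exp (-x) * Real.exp (x - y) := by
      rw [← Real.exp_add]; ring_nf
    rw [hl, this]
    have := (hpos (-x)).ne'
    field_simp
    ring
  have h3 : Real.log (Real.exp (l * (x - y)) * (1 + Real.exp (-x)))
      ≤ Real.log (1 + Real.exp (-y)) := by
    refine Real.log_le_log (by positivity) ?_
    rw [← h2]
    exact mul_le_mul_of_nonneg_right h1 (hpos _).le
  rw [Real.log_mul (Real.exp_pos _).ne' (hpos _).ne', Real.log_exp] at h3
  unfold logistic
  linarith

lemma exists_slope_hinge (x : ℝ) :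
    ∃ l : ℝ, 0 ≤ l ∧ l ≤ 1 ∧ ∀ y, hinge x - l * (y - x) ≤ hinge y := by
  rcases le_total x 1 with hx | hx
  · refine ⟨1, zero_le_one, le_rfl, fun y => ?_⟩
    rw [hinge, hinge, max_eq_right (by linarith)]
    refine le_trans ?_ (le_max_right _ _)
    linarith
  · refine ⟨0, le_rfl, zero_le_one, fun y => ?_⟩
    rw [hinge, hinge, max_eq_left (by linarith)]
    simp

/-- Convexity, monotonicity and the Lipschitz constant `1` in a single statement: a supporting line
with slope `-l` in `[-1, 0]`. -/
lemma exists_slope {h : ℝ → ℝ} (hh : h = logistic ∨ h = hinge) (x : ℝ) :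
    ∃ l : ℝ, 0 ≤ l ∧ l ≤ 1 ∧ ∀ y, h x - l * (y - x) ≤ h y := by
  rcases hh with rfl | rfl
  exacts [exists_slope_logistic x, exists_slope_hinge x]

lemma marginLoss_nonneg {h : ℝ → ℝ} (hh : h = logistic ∨ h = hinge) (x : ℝ) : 0 ≤ h x := by
  rcases hh with rfl | rfl
  · exact Real.log_nonneg (by linarith [Real.exp_pos (-x)])
  · exact le_max_left _ _

lemma marginLoss_le {h : ℝ → ℝ} (hh : h = logistic ∨ h = hinge) (x : ℝ) : h x ≤ 1 + |x| := by
  obtain ⟨l, hl0, hl1, hl⟩ := exists_slope hh x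
  have h0 : h 0 ≤ 1 := by
    rcases hh with rfl | rfl
    · have := Real.log_two_lt_d9
      simp only [logistic, neg_zero, Real.exp_zero, one_add_one_eq_two]
      linarith
    · simp [hinge]
  have h1 := hl 0
  have h2 : -(l * x) ≤ |x| := by
    calc -(l * x) ≤ |l * x| := neg_le_abs _
      _ = l * |x| := by rw [abs_mul, abs_of_nonneg hl0]
      _ ≤ |x| := mul_le_of_le_one_left (abs_nonneg _) hl1
  linarith

end MarginLosses

/-! ### Singular values and comparison of norms -/

section Norms

variable {d : ℕ}

/-- In an orthonormal eigenbasis of `A* A` the form `‖A v‖²` is diagonal, with the squared singular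
values as coefficients, each at least `ε²`. -/
lemma mul_norm_le_of_le_smallestSingularValue (hd : 0 < d) {ε : ℝ} (hε : 0 ≤ ε)
    {A : Vec d →ₗ[ℝ] Vec d} (hA : ε ≤ smallestSingularValue A) (v : Vec d) :
    ε * ‖v‖ ≤ ‖A v‖ := by
  have hfr : Module.finrank ℝ (Vec d) = d := finrank_euclideanSpace_fin
  have hsym := A.isSymmetric_adjoint_comp_self
  have hev : ∀ i : Fin d, ε ^ 2 ≤ hsym.eigenvalues hfr i := fun i => by
    rw [← A.sq_singularValues_fin hfr i]
    gcongr
    exact hA.trans (A.singularValues_antitone (by have := i.2; omega))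
  set b := hsym.eigenvectorBasis hfr
  have h1 : ‖A v‖ ^ 2 = ∑ i, hsym.eigenvalues hfr i * ‖inner ℝ (b i) v‖ ^ 2 := by
    have e : ‖A v‖ ^ 2 = inner ℝ v ((A.adjoint ∘ₗ A) v) := by
      rw [LinearMap.comp_apply, LinearMap.adjoint_inner_right, real_inner_self_eq_norm_sq]
    rw [e, ← b.sum_inner_mul_inner]
    refine Finset.sum_congr rfl fun i _ => ?_
    have : inner ℝ (b i) ((A.adjoint ∘ₗ A) v) = hsym.eigenvalues hfr i * inner ℝ (b i) v := by
      rw [← hsym (b i) v, hsym.apply_eigenvectorBasis hfr i, inner_smul_left]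
      rfl
    rw [this, real_inner_comm, Real.norm_eq_abs, sq_abs]
    ring
  have h2 : (ε * ‖v‖) ^ 2 ≤ ‖A v‖ ^ 2 := by
    rw [h1, mul_pow, ← b.sum_sq_norm_inner_right v, Finset.mul_sum]
    gcongr with i
    exact hev i
  exact le_of_sq_le_sq h2 (norm_nonneg _)

lemma lpNorm_nonneg (p : ℝ≥0∞) [Fact (1 ≤ p)] (v : Vec d) : 0 ≤ lpNorm p v := norm_nonneg _

lemma lpNorm_smul (p : ℝ≥0∞) [Fact (1 ≤ p)] (c : ℝ) (v : Vec d) :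
    lpNorm p (c • v) = |c| * lpNorm p v := by
  rw [lpNorm, lpNorm, WithLp.ofLp_smul, WithLp.toLp_smul, norm_smul, Real.norm_eq_abs]

/-- Write `|v i|² = |v i|^p |v i|^(2-p)`, bound the second factor by the `ℓ^p` norm to the power `2
- p`, and sum. -/
lemma norm_le_lpNorm_of_le_two {p : ℝ≥0∞} [Fact (1 ≤ p)] (hp2 : p ≤ 2) (v : Vec d) :
    ‖v‖ ≤ lpNorm p v := by
  have hptop : p ≠ ⊤ := fun h => by simp [h] at hp2
  have hp1 : 1 ≤ p.toReal := by simpa using ENNReal.toReal_mono hptop (Fact.out : 1 ≤ p)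
  have hp2' : p.toReal ≤ 2 := by simpa using ENNReal.toReal_mono (by simp) hp2
  have hN := lpNorm_nonneg p v
  have hsum : lpNorm p v ^ p.toReal = ∑ i, |v i| ^ p.toReal := by
    rw [lpNorm, PiLp.norm_eq_sum (by linarith), ← Real.rpow_mul (by positivity),
      one_div_mul_cancel (by linarith), Real.rpow_one]
    rfl
  have hi : ∀ i, |v i| ≤ lpNorm p v := fun i => PiLp.norm_apply_le (WithLp.toLp p v.ofLp) i
  have h2 : ‖v‖ ^ 2 ≤ lpNorm p v ^ 2 := by
    rw [EuclideanSpace.norm_sq_eq]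
    have split : ∀ x : ℝ, 0 ≤ x → x ^ 2 = x ^ p.toReal * x ^ (2 - p.toReal) := fun x hx => by
      rw [← Real.rpow_add_of_nonneg hx (by linarith) (by linarith), add_sub_cancel]
      norm_cast
    rw [split _ hN, hsum, Finset.sum_mul]
    gcongr with i
    rw [Real.norm_eq_abs, split _ (abs_nonneg _)]
    exact mul_le_mul_of_nonneg_left (Real.rpow_le_rpow (abs_nonneg _) (hi i) (by linarith))
      (by positivity)
  exact le_of_sq_le_sq h2 hN

/-- For finite `p` this is the power mean inequality with exponent `p / 2 ≥ 1` for the numbers `v i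
^ 2`. -/
lemma norm_le_rpow_mul_lpNorm (hd : 0 < d) {p : ℝ≥0∞} [Fact (1 ≤ p)] (hp2 : 2 ≤ p) (v : Vec d) :
    ‖v‖ ≤ (d : ℝ) ^ (1 / 2 - (p⁻¹).toReal) * lpNorm p v := by
  have hN := lpNorm_nonneg p v
  have hd' : (0 : ℝ) < d := by exact_mod_cast hd
  refine le_of_sq_le_sq ?_ (by positivity)
  rw [EuclideanSpace.norm_sq_eq, mul_pow, ← Real.rpow_natCast (_ ^ _) 2, ← Real.rpow_mul hd'.le]
  by_cases hptop : p = ⊤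
  · subst hptop
    have hi : ∀ i, |v i| ≤ lpNorm ⊤ v := fun i => PiLp.norm_apply_le (WithLp.toLp ⊤ v.ofLp) i
    calc ∑ i, ‖v i‖ ^ 2 ≤ ∑ _i : Fin d, lpNorm ⊤ v ^ 2 := by
          gcongr with i; exact hi i
      _ = _ := by simp
  have hp2' : 2 ≤ p.toReal := by simpa using ENNReal.toReal_mono hptop hp2
  have hp0 : 0 < p.toReal := by linarith
  have hsum : lpNorm p v ^ p.toReal = ∑ i, |v i| ^ p.toReal := by
    rw [lpNorm, PiLp.norm_eq_sum (by linarith), ← Real.rpow_mul (by positivity),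
      one_div_mul_cancel (by linarith), Real.rpow_one]
    rfl
  have key := Real.rpow_sum_le_const_mul_sum_rpow Finset.univ (fun i => v i ^ 2)
    (p := p.toReal / 2) (by linarith)
  simp only [abs_pow, sq_abs, Finset.card_univ, Fintype.card_fin] at key
  have e : ∀ i, (v i ^ 2) ^ (p.toReal / 2) = |v i| ^ p.toReal := fun i => by
    rw [← sq_abs, ← Real.rpow_natCast, ← Real.rpow_mul (abs_nonneg _)]
    congr 1; push_cast; ring
  simp only [e, ← hsum] at key
  have := Real.rpow_le_rpow (by positivity) key (by positivity : 0 ≤ (p.toReal / 2)⁻¹)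
  rw [Real.rpow_rpow_inv (by positivity) (by positivity),
    Real.mul_rpow (by positivity) (by positivity), ← Real.rpow_mul hd'.le,
    ← Real.rpow_mul hN] at this
  simp only [Real.norm_eq_abs, sq_abs]
  refine this.trans (le_of_eq ?_)
  rw [ENNReal.toReal_inv, ← Real.rpow_natCast (lpNorm p v) 2]
  congr 2 <;> field_simp <;> push_cast <;> ring

/-- The comparison constant between the Euclidean and the `ℓ^p` norm. -/
lemma norm_le_dim_mul_lpNorm (hd : 0 < d) {p q : ℝ≥0∞} (hpq : p.HolderConjugate q) (v : Vec d) :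
    ‖v‖ ≤ (d : ℝ) ^ max ((q⁻¹).toReal - 1 / 2) 0 * lpNorm p v := by
  have hp1 : Fact (1 ≤ p) := ⟨hpq.one_le⟩
  have hd' : (1 : ℝ) ≤ d := by exact_mod_cast hd
  have hpi : p⁻¹ ≠ ⊤ := by
    simpa using (zero_lt_one.trans_le hp1.out).ne'
  have hqi : q⁻¹ ≠ ⊤ := by
    simpa using (zero_lt_one.trans_le hpq.symm.one_le).ne'
  have hsum : (p⁻¹).toReal + (q⁻¹).toReal = 1 := by
    rw [← ENNReal.toReal_add hpi hqi, hpq.inv_add_inv_eq_one]; simp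
  rcases le_total p 2 with h | h
  · refine (norm_le_lpNorm_of_le_two h v).trans (le_mul_of_one_le_left (lpNorm_nonneg p v) ?_)
    exact Real.one_le_rpow hd' (le_max_right _ _)
  · refine (norm_le_rpow_mul_lpNorm hd h v).trans ?_
    exact mul_le_mul_of_nonneg_right (Real.rpow_le_rpow_of_exponent_le hd'
      (le_max_of_le_left (by linarith))) (lpNorm_nonneg p v)

end Norms

/-! ### Best responses of strategic agents -/

section Responses

variable {d : ℕ}

lemma costFactor_nonneg {ε s : ℝ} (hε : 0 < ε) (q : ℝ≥0∞) (d : ℕ) : 0 ≤ costFactor ε s q d := by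
  unfold costFactor; positivity

lemma costFactor_eq {ε s : ℝ} (hε : 0 < ε) (hs : 0 ≤ s) (q : ℝ≥0∞) (d : ℕ) :
    costFactor ε s q d = ((d : ℝ) ^ max ((q⁻¹).toReal - 1 / 2) 0 / ε) ^ s := by
  rw [costFactor, dimExponent, Real.div_rpow (by positivity) hε.le, ← Real.rpow_mul (by positivity),
    Real.rpow_neg hε.le, max_mul_of_nonneg _ _ hs, zero_mul,
    show ((q⁻¹).toReal - 1 / 2) * s = s * (q⁻¹).toReal - s / 2 by ring]
  exact inv_mul_eq_div _ _

variable {r s ε : ℝ} {p q : ℝ≥0∞} {a : Agent d} {A : Vec d →ₗ[ℝ] Vec d} {β z : Vec d}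

/-- First-order optimality of a report along the ray from the true features. -/
lemma inner_response_sub (hr : 1 < r) [Fact (1 ≤ p)]
    (hcost : ∀ z, a.cost a.x z = 1 / r * lpNorm p (A (a.x - z)) ^ r)
    (hz : ∀ w, a.utility w β ≤ a.utility z β) :
    inner ℝ β (z - a.x) = lpNorm p (A (a.x - z)) ^ r := by
  set N := lpNorm p (A (a.x - z)) with hN
  have hN0 : 0 ≤ N := lpNorm_nonneg _ _
  set g : ℝ → ℝ := fun τ => τ * inner ℝ β (z - a.x) - 1 / r * (τ ^ r * N ^ r) with hg
  have hval : ∀ τ : ℝ, 0 < τ →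
      a.utility (a.x + τ • (z - a.x)) β = inner ℝ β a.x + g τ := fun τ hτ => by
    have e : a.x - (a.x + τ • (z - a.x)) = τ • (a.x - z) := by module
    rw [Agent.utility, hcost, e, map_smul, lpNorm_smul, abs_of_pos hτ,
      Real.mul_rpow hτ.le (lpNorm_nonneg _ _), inner_add_right, inner_smul_right]
    simp only [hg, hN]
    ring
  -- The value `τ = 1` is the report `z` itself. Vanishing of the derivative there is the claim, the
  -- factor `r` cancelling `1 / r`.
  have hmax : IsLocalMax g 1 := by
    filter_upwards [Ioi_mem_nhds (zero_lt_one' ℝ)] with τ hτ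
    have h1 := hval τ hτ
    have h2 := hval 1 one_pos
    rw [one_smul, add_sub_cancel] at h2
    have := hz (a.x + τ • (z - a.x))
    linarith
  have hder : HasDerivAt g (1 * inner ℝ β (z - a.x) - 1 / r * (r * (1 : ℝ) ^ (r - 1) * N ^ r)) 1 :=
    ((hasDerivAt_id 1).mul_const _).sub
      (((Real.hasDerivAt_rpow_const (Or.inl one_ne_zero)).mul_const _).const_mul _)
  have h0 := hmax.hasDerivAt_eq_zero hder
  rw [Real.one_rpow] at h0
  have hr0 : r ≠ 0 := by linarith
  field_simp at h0
  linarith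

/-- A bootstrap: `‖z - x‖ ≤ (D / ε) N`, while `N ^ r = ⟨β, z - x⟩ ≤ ‖β‖ (D / ε) N`. The second bound
controls `N`, and the first then controls the displacement. -/
lemma norm_response_sub_le (hrs : r.HolderConjugate s) (hε : 0 < ε) (hd : 0 < d)
    (hpq : p.HolderConjugate q) (hA : ε ≤ smallestSingularValue A)
    (hcost : ∀ z, a.cost a.x z = 1 / r * lpNorm p (A (a.x - z)) ^ r)
    (hz : ∀ w, a.utility w β ≤ a.utility z β) :
    ‖z - a.x‖ ≤ costFactor ε s q d * ‖β‖ ^ (s - 1) := by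
  have hp1 : Fact (1 ≤ p) := ⟨hpq.one_le⟩
  have hr := hrs.lt
  have hs := hrs.symm.lt
  rw [costFactor_eq hε (by linarith)]
  set D := (d : ℝ) ^ max ((q⁻¹).toReal - 1 / 2) 0
  have hD : 0 ≤ D := by positivity
  have h1 := inner_response_sub hr hcost hz
  set N := lpNorm p (A (a.x - z)) with hN
  have hN0 : 0 ≤ N := lpNorm_nonneg _ _
  have h2 : ‖z - a.x‖ ≤ D / ε * N := by
    have := (mul_norm_le_of_le_smallestSingularValue hd hε.le hA (a.x - z)).trans
      (norm_le_dim_mul_lpNorm hd hpq _)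
    rw [norm_sub_rev] at this
    rw [div_mul_eq_mul_div, le_div_iff₀ hε]
    linarith
  have h3 : N ≤ (‖β‖ * (D / ε)) ^ (s - 1) := by
    rcases hN0.eq_or_lt with h0 | h0
    · rw [← h0]; positivity
    have h4 : N ^ (r - 1) ≤ ‖β‖ * (D / ε) := by
      refine le_of_mul_le_mul_right ?_ h0
      calc N ^ (r - 1) * N = N ^ r := by
            rw [← Real.rpow_add_one h0.ne', sub_add_cancel]
        _ = inner ℝ β (z - a.x) := h1.symm
        _ ≤ ‖β‖ * ‖z - a.x‖ := real_inner_le_norm _ _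
        _ ≤ ‖β‖ * (D / ε * N) := by gcongr
        _ = _ := by ring
    -- Conjugacy means `(r - 1)(s - 1) = 1`, so the power `s - 1` undoes the power `r - 1`.
    have h5 := Real.rpow_le_rpow (by positivity) h4 (by linarith : 0 ≤ s - 1)
    rwa [← Real.rpow_mul hN0, show (r - 1) * (s - 1) = 1 by linarith [hrs.mul_eq_add], Real.rpow_one] at h5
  calc ‖z - a.x‖ ≤ D / ε * N := h2
    _ ≤ D / ε * (‖β‖ * (D / ε)) ^ (s - 1) := by gcongr
    _ = (D / ε) ^ s * ‖β‖ ^ (s - 1) := by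
      rw [Real.mul_rpow (by positivity) (by positivity)]
      have : (D / ε) ^ s = (D / ε) * (D / ε) ^ (s - 1) := by
        have := Real.rpow_add_of_nonneg (by positivity : 0 ≤ D / ε) zero_le_one
          (by linarith : 0 ≤ s - 1)
        rwa [add_sub_cancel, Real.rpow_one] at this
      rw [this]; ring

/-- The margin of a strategic agent is a convex function of the classifier. -/
lemma margin_subgradient (hrs : r.HolderConjugate s) [Fact (1 ≤ p)]
    (hcost : ∀ z, a.cost a.x z = 1 / r * lpNorm p (A (a.x - z)) ^ r)
    (hz : ∀ w, a.utility w β ≤ a.utility z β) {β' z' : Vec d}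
    (hz' : ∀ w, a.utility w β' ≤ a.utility z' β') :
    inner ℝ z β + inner ℝ (a.x + s • (z - a.x)) (β' - β) ≤ inner ℝ z' β' := by
  have h1 := inner_response_sub hrs.lt hcost hz
  have h2 := inner_response_sub hrs.lt hcost hz'
  -- The report `z` competes with `z'` under the classifier `β'`. Once both costs are replaced by
  -- inner products, this is linear; multiplying by `s` and using `s / r = s - 1` gives the claim.
  have h3 := hz' z
  rw [Agent.utility, Agent.utility, hcost, hcost, ← h1, ← h2] at h3
  have hs : 0 < s := hrs.symm.pos
  have e : s * (1 / r) = s - 1 := by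
    rw [mul_one_div]; have := hrs.symm.sub_one_mul_conj; have := hrs.pos.ne'
    field_simp; linarith
  have h4 := mul_le_mul_of_nonneg_left h3 hs.le
  rw [mul_sub, mul_sub, ← mul_assoc, ← mul_assoc, e] at h4
  simp only [inner_sub_right, inner_add_right, inner_smul_right,
    real_inner_comm β, real_inner_comm β'] at h4 ⊢
  linarith

end Responses

/-- What the analysis of the algorithm uses about an interaction: convex losses, bounded by `M` and
with subgradients bounded by `L` on the feasible set. -/
structure Interaction.Regular {d n : ℕ} (P : Interaction d n) (M L R : ℝ) : Prop where
  convex : Convex ℝ P.K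
  closed : IsClosed P.K
  ball_subset : Metric.closedBall 0 1 ⊆ P.K
  norm_le : ∀ β ∈ P.K, ‖β‖ ≤ R
  exists_subgradient : ∀ t β, ∃ v, IsSubgradient (P.loss t) β v ∧ (β ∈ P.K → ‖v‖ ≤ L)
  loss_nonneg : ∀ t β, 0 ≤ P.loss t β
  loss_le : ∀ t, ∀ β ∈ P.K, P.loss t β ≤ M
  norm_sub_le : ∀ t, (P.agent t).y = 1 → ∀ β, ‖P.sub t β‖ ≤ L
  sub_mem : ∀ t, (P.agent t).y = 1 → ∀ β, IsSubgradient (P.loss t) β (P.sub t β)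
  sub_measurable : ∀ t, (P.agent t).y = 1 → Measurable (P.sub t)

/-! ### Convexity and bounds for the induced losses -/

section Admissible

variable {d n : ℕ} {P : Interaction d n} {R₁ R₂ ε r s κ : ℝ} {p q : ℝ≥0∞}

lemma Interaction.Admissible.loss_of_label_one (hP : P.Admissible R₁ R₂ ε r p) {t : Fin n}
    (ht : (P.agent t).y = 1) (β : Vec d) : P.loss t β = P.h (inner ℝ (P.agent t).x β) := by
  rw [Interaction.loss, ht, (hP.response t β).2 ht]; simp

lemma Interaction.Admissible.loss_of_label_neg (_hP : P.Admissible R₁ R₂ ε r p) {t : Fin n}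
    (ht : (P.agent t).y = -1) (β : Vec d) : P.loss t β = P.h (-inner ℝ (P.resp t β) β) := by
  rw [Interaction.loss, ht]; simp

/-- Chain rule: the slope of a supporting line of `h` times a subgradient of the margin. The sign `l
≥ 0` is what preserves the inequality in strategic rounds. The bound on `κ` is required only in
those rounds, so that `κ = 0` is allowed when there are none. -/
lemma Interaction.Admissible.exists_subgradient (hP : P.Admissible R₁ R₂ ε r p)
    (hrs : r.HolderConjugate s) (hε : 0 < ε) (hd : 0 < d) (hpq : p.HolderConjugate q)
    (hR₂ : 0 < R₂) (hκ0 : 0 ≤ κ) (hκ : ∀ t, (P.agent t).y = -1 → costFactor ε s q d ≤ κ)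
    (t : Fin n) (β : Vec d) :
    ∃ v, IsSubgradient (P.loss t) β v ∧ (‖β‖ ≤ R₂ → ‖v‖ ≤ lossLip R₁ R₂ s κ) := by
  have hs := hrs.symm.lt
  have hnn : 0 ≤ s * κ * R₂ ^ (s - 1) := by positivity
  have hx := hP.feature_le t
  rcases Int.units_eq_one_or (P.agent t).y with ht | ht
  · obtain ⟨l, hl0, hl1, hl⟩ := exists_slope hP.loss_eq (inner ℝ (P.agent t).x β)
    refine ⟨-l • (P.agent t).x, fun β' => ?_, fun _ => ?_⟩
    · have := hl (inner ℝ (P.agent t).x β')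
      rw [hP.loss_of_label_one ht, hP.loss_of_label_one ht, real_inner_smul_left, inner_sub_right]
      linarith
    · rw [norm_smul, norm_neg, Real.norm_of_nonneg hl0, lossLip]
      have := mul_le_of_le_one_left (norm_nonneg (P.agent t).x) hl1
      linarith
  · have hp1 : Fact (1 ≤ p) := ⟨hpq.one_le⟩
    obtain ⟨A, hA, hcost⟩ := hP.cost_eq t ht
    have hz : ∀ β, ∀ w, (P.agent t).utility w β ≤ (P.agent t).utility (P.resp t β) β :=
      fun β => (hP.response t β).1 ht
    obtain ⟨l, hl0, hl1, hl⟩ := exists_slope hP.loss_eq (-inner ℝ (P.resp t β) β)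
    refine ⟨l • ((P.agent t).x + s • (P.resp t β - (P.agent t).x)), fun β' => ?_, fun hβ => ?_⟩
    · have h1 := hl (-inner ℝ (P.resp t β') β')
      have h2 := mul_le_mul_of_nonneg_left (margin_subgradient hrs hcost (hz β) (hz β')) hl0
      rw [hP.loss_of_label_neg ht, hP.loss_of_label_neg ht, real_inner_smul_left]
      linarith
    · rw [norm_smul, Real.norm_of_nonneg hl0, lossLip]
      refine (mul_le_of_le_one_left (norm_nonneg _) hl1).trans ((norm_add_le _ _).trans ?_)
      rw [norm_smul, Real.norm_of_nonneg (by linarith), mul_assoc s]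
      have h1 := norm_response_sub_le hrs hε hd hpq hA hcost (hz β)
      gcongr
      refine h1.trans ?_
      gcongr
      · exact hκ t ht

lemma Interaction.Admissible.loss_le (hP : P.Admissible R₁ R₂ ε r p)
    (hrs : r.HolderConjugate s) (hε : 0 < ε) (hd : 0 < d) (hpq : p.HolderConjugate q)
    (hR₁ : 0 < R₁) (hR₂ : 0 < R₂) (hκ0 : 0 ≤ κ)
    (hκ : ∀ t, (P.agent t).y = -1 → costFactor ε s q d ≤ κ)
    (t : Fin n) {β : Vec d} (hβ : ‖β‖ ≤ R₂) : P.loss t β ≤ lossBound R₁ R₂ s κ := by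
  have hs := hrs.symm.lt
  have hx := hP.feature_le t
  have hnn : 0 ≤ κ * R₂ ^ s := by positivity
  have h0 : |inner ℝ (P.agent t).x β| ≤ R₁ * R₂ :=
    (abs_real_inner_le_norm _ _).trans (by gcongr)
  rw [lossBound]
  rcases Int.units_eq_one_or (P.agent t).y with ht | ht
  · rw [hP.loss_of_label_one ht]
    have := marginLoss_le hP.loss_eq (inner ℝ (P.agent t).x β)
    linarith
  · have hp1 : Fact (1 ≤ p) := ⟨hpq.one_le⟩
    obtain ⟨A, hA, hcost⟩ := hP.cost_eq t ht
    have h1 := norm_response_sub_le hrs hε hd hpq hA hcost ((hP.response t β).1 ht)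
    rw [hP.loss_of_label_neg ht]
    refine (marginLoss_le hP.loss_eq _).trans ?_
    have h2 : inner ℝ (P.resp t β) β
        = inner ℝ (P.agent t).x β + inner ℝ (P.resp t β - (P.agent t).x) β := by
      rw [← inner_add_left, add_sub_cancel]
    have h3 : |inner ℝ (P.resp t β - (P.agent t).x) β| ≤ κ * R₂ ^ s := by
      calc _ ≤ ‖P.resp t β - (P.agent t).x‖ * ‖β‖ := abs_real_inner_le_norm _ _
        _ ≤ (κ * R₂ ^ (s - 1)) * R₂ := by
          gcongr
          refine h1.trans ?_
          gcongr
          · exact hκ t ht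
        _ = κ * R₂ ^ s := by
          rw [mul_assoc, ← Real.rpow_add_one hR₂.ne', sub_add_cancel]
    rw [abs_neg, h2]
    linarith [abs_add_le (inner ℝ (P.agent t).x β) (inner ℝ (P.resp t β - (P.agent t).x) β)]

/-- Testing the subgradient `v` in its own direction, at `β + v`, gives `‖v‖² ≤ R₁ ‖v‖`, since the
loss of a truthful agent is `R₁`-Lipschitz. -/
lemma Interaction.Admissible.norm_sub_le (hP : P.Admissible R₁ R₂ ε r p) (t : Fin n)
    (ht : (P.agent t).y = 1) (β : Vec d) : ‖P.sub t β‖ ≤ R₁ := by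
  set v := P.sub t β with hv
  have h1 := hP.sub_mem t ht β (β + v)
  obtain ⟨l, hl0, hl1, hl⟩ := exists_slope hP.loss_eq (inner ℝ (P.agent t).x (β + v))
  have h2 := hl (inner ℝ (P.agent t).x β)
  rw [hP.loss_of_label_one ht, hP.loss_of_label_one ht, add_sub_cancel_left, ← hv,
    real_inner_self_eq_norm_sq] at h1
  have h3 : l * (inner ℝ (P.agent t).x β - inner ℝ (P.agent t).x (β + v)) ≤ R₁ * ‖v‖ := by
    rw [← inner_sub_right, sub_add_cancel_left]
    have hR : |inner ℝ (P.agent t).x (-v)| ≤ R₁ * ‖v‖ := by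
      refine (abs_real_inner_le_norm _ _).trans ?_
      rw [norm_neg]; gcongr; exact hP.feature_le t
    have h4 := (le_abs_self (l * inner ℝ (P.agent t).x (-v)))
    rw [abs_mul, abs_of_nonneg hl0] at h4
    exact h4.trans ((mul_le_of_le_one_left (abs_nonneg _) hl1).trans hR)
  rcases (norm_nonneg v).eq_or_lt with h0 | h0
  · rw [← h0]; exact (norm_nonneg _).trans (hP.feature_le t)
  · nlinarith

theorem Interaction.Admissible.regular (hP : P.Admissible R₁ R₂ ε r p)
    (hrs : r.HolderConjugate s) (hε : 0 < ε) (hd : 0 < d) (hpq : p.HolderConjugate q)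
    (hR₁ : 0 < R₁) (hR₂ : 0 < R₂) (hκ0 : 0 ≤ κ)
    (hκ : ∀ t, (P.agent t).y = -1 → costFactor ε s q d ≤ κ) :
    P.Regular (lossBound R₁ R₂ s κ) (lossLip R₁ R₂ s κ) R₂ where
  convex := hP.convex
  closed := hP.closed
  ball_subset := hP.ball_subset
  norm_le := hP.norm_le
  exists_subgradient t β := by
    obtain ⟨v, hv, hv'⟩ := hP.exists_subgradient hrs hε hd hpq hR₂ hκ0 hκ t β
    exact ⟨v, hv, fun h => hv' (hP.norm_le β h)⟩
  loss_nonneg t β := marginLoss_nonneg hP.loss_eq _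
  loss_le t β hβ := hP.loss_le hrs hε hd hpq hR₁ hR₂ hκ0 hκ t (hP.norm_le β hβ)
  norm_sub_le t ht β := by
    refine (hP.norm_sub_le t ht β).trans ?_
    have := hrs.symm.pos
    have : 0 ≤ s * κ * R₂ ^ (s - 1) := by positivity
    rw [lossLip]; linarith
  sub_mem := hP.sub_mem
  sub_measurable := hP.sub_measurable

end Admissible

/-! ### Euclidean projection onto a closed convex set -/

section Projection

variable {d : ℕ} {K : Set (Vec d)}

lemma proj_spec (hne : K.Nonempty) (hcl : IsClosed K) (z : Vec d) :
    proj K z ∈ K ∧ ∀ v ∈ K, dist z (proj K z) ≤ dist z v := by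
  refine Classical.epsilon_spec (p := fun w => w ∈ K ∧ ∀ v ∈ K, dist z w ≤ dist z v) ?_
  obtain ⟨w, hw, hw'⟩ := hcl.exists_infDist_eq_dist hne z
  exact ⟨w, hw, fun v hv => hw' ▸ infDist_le_dist_of_mem hv⟩

lemma inner_sub_proj_le_zero (hc : Convex ℝ K) (hne : K.Nonempty) (hcl : IsClosed K) (z : Vec d)
    {v : Vec d} (hv : v ∈ K) : inner ℝ (z - proj K z) (v - proj K z) ≤ 0 := by
  obtain ⟨h1, h2⟩ := proj_spec hne hcl z
  have : Nonempty K := ⟨⟨_, h1⟩⟩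
  refine (norm_eq_iInf_iff_real_inner_le_zero hc h1).1 (le_antisymm ?_ ?_) v hv
  · exact le_ciInf fun w => by simpa [dist_eq_norm] using h2 w w.2
  · exact ciInf_le ⟨0, by rintro _ ⟨w, rfl⟩; exact norm_nonneg _⟩ (⟨_, h1⟩ : K)

lemma dist_proj_proj_le (hc : Convex ℝ K) (hne : K.Nonempty) (hcl : IsClosed K) (y z : Vec d) :
    dist (proj K y) (proj K z) ≤ dist y z := by
  have h1 := inner_sub_proj_le_zero hc hne hcl y (proj_spec hne hcl z).1
  have h2 := inner_sub_proj_le_zero hc hne hcl z (proj_spec hne hcl y).1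
  set a := proj K y
  set b := proj K z
  have h3 : ‖a - b‖ ^ 2 ≤ inner ℝ (y - z) (a - b) := by
    rw [← real_inner_self_eq_norm_sq]
    simp only [inner_sub_left, inner_sub_right] at *
    linarith
  have h4 := real_inner_le_norm (y - z) (a - b)
  rw [dist_eq_norm, dist_eq_norm]
  rcases (norm_nonneg (a - b)).eq_or_lt with h0 | h0
  · rw [← h0]; exact norm_nonneg _
  · nlinarith

lemma continuous_proj (hc : Convex ℝ K) (hne : K.Nonempty) (hcl : IsClosed K) :
    Continuous (proj K) :=
  (LipschitzWith.of_dist_le_mul (K := 1) fun y z => by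
    simpa using dist_proj_proj_le hc hne hcl y z).continuous

lemma norm_proj_sub_le (hc : Convex ℝ K) (hne : K.Nonempty) (hcl : IsClosed K) (z : Vec d)
    {v : Vec d} (hv : v ∈ K) : ‖proj K z - v‖ ≤ ‖z - v‖ := by
  have h1 := inner_sub_proj_le_zero hc hne hcl z hv
  refine le_of_sq_le_sq ?_ (norm_nonneg _)
  have e : z - v = (z - proj K z) + (proj K z - v) := by abel
  rw [e, norm_add_sq_real, ← neg_sub v, inner_neg_right]
  nlinarith [sq_nonneg ‖z - proj K z‖]

end Projection

/-! ### Conditioning on all but one coordinate of a product measure -/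

section FreshCoordinate

variable {ι Ω : Type*} [Fintype ι] [DecidableEq ι] [MeasurableSpace Ω]

/-- Resampling one independent coordinate does not change the law; this stands in for conditional
expectations. -/
lemma measurePreserving_update (ν : Measure Ω) [IsProbabilityMeasure ν] (t : ι) :
    MeasurePreserving (fun x : (ι → Ω) × Ω => Function.update x.1 t x.2)
      ((Measure.pi fun _ : ι => ν).prod ν) (Measure.pi fun _ : ι => ν) := by
  have hm : Measurable fun x : (ι → Ω) × Ω => Function.update x.1 t x.2 := by
    refine measurable_pi_lambda _ fun i => ?_
    by_cases hi : i = t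
    · subst hi; simpa using measurable_snd
    · simpa [hi, Function.comp_def] using (measurable_pi_apply i).comp measurable_fst
  refine ⟨hm, (Measure.pi_eq fun s hs => ?_).symm⟩
  rw [Measure.map_apply hm (MeasurableSet.univ_pi hs)]
  have : (fun x : (ι → Ω) × Ω => Function.update x.1 t x.2) ⁻¹' (pi univ s)
      = (pi univ (Function.update s t univ)) ×ˢ s t := by
    ext ⟨S, u⟩
    simp only [mem_preimage, mem_univ_pi, mem_prod]
    constructor
    · refine fun h => ⟨fun i => ?_, by simpa using h t⟩
      by_cases hi : i = t
      · subst hi; simp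
      · simpa [hi] using h i
    · rintro ⟨h1, h2⟩ i
      by_cases hi : i = t
      · subst hi; simpa using h2
      · simpa [hi] using h1 i
  rw [this, Measure.prod_prod, Measure.pi_pi, ← Finset.mul_prod_erase _ _ (Finset.mem_univ t),
    ← Finset.mul_prod_erase _ (fun i => ν (s i)) (Finset.mem_univ t), Function.update_self,
    measure_univ, one_mul, mul_comm]
  congr 1
  refine Finset.prod_congr rfl fun i hi => ?_
  rw [Function.update_of_ne (Finset.ne_of_mem_erase hi)]

/-- A bound for the conditional expectation given the other coordinates is a bound for the
expectation. -/
lemma integral_le_of_fresh_coordinate {E : Type*} [MeasurableSpace E] (ν : Measure Ω)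
    [IsProbabilityMeasure ν] (t : ι) {X : (ι → Ω) → E} (hX : Measurable X)
    (hfresh : ∀ S u, X (Function.update S t u) = X S)
    {H : E → Ω → ℝ} (hH : Measurable (Function.uncurry H)) {B b : ℝ}
    (hB : ∀ S u, |H (X S) u| ≤ B) (hb : ∀ S, ∫ u, H (X S) u ∂ν ≤ b) :
    ∫ S, H (X S) (S t) ∂(Measure.pi fun _ : ι => ν) ≤ b := by
  have hm : Measurable fun S : ι → Ω => H (X S) (S t) :=
    hH.comp (hX.prodMk (measurable_pi_apply t))
  have hm2 : Measurable fun x : (ι → Ω) × Ω => H (X x.1) x.2 :=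
    hH.comp ((hX.comp measurable_fst).prodMk measurable_snd)
  have hint : Integrable (fun x : (ι → Ω) × Ω => H (X x.1) x.2)
      ((Measure.pi fun _ : ι => ν).prod ν) :=
    Integrable.of_bound hm2.aestronglyMeasurable B (.of_forall fun x => hB _ _)
  have hmp := measurePreserving_update ν t
  calc ∫ S, H (X S) (S t) ∂(Measure.pi fun _ : ι => ν)
      = ∫ x, H (X x.1) x.2 ∂((Measure.pi fun _ : ι => ν).prod ν) := by
        have := integral_map (μ := (Measure.pi fun _ : ι => ν).prod ν) hmp.measurable.aemeasurable
          hm.aestronglyMeasurable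
        rw [hmp.map_eq] at this
        simpa [hfresh] using this
    _ = ∫ S, ∫ u, H (X S) u ∂ν ∂(Measure.pi fun _ : ι => ν) := integral_prod _ hint
    _ ≤ ∫ _S : ι → Ω, b ∂(Measure.pi fun _ : ι => ν) :=
        integral_mono hint.integral_prod_left (integrable_const _) hb
    _ = b := by simp

end FreshCoordinate

/-- The regret bound of projected gradient descent along a trajectory. -/
lemma sum_inner_le_of_step {d n : ℕ} {η : ℝ} (hη : 0 < η) (x : Fin (n + 1) → Vec d)
    (g : Fin n → Vec d) (v : Vec d)
    (hstep : ∀ t : Fin n, ‖x t.succ - v‖ ≤ ‖x t.castSucc - η • g t - v‖) :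
    ∑ t, inner ℝ (g t) (x t.castSucc - v)
      ≤ ‖x 0 - v‖ ^ 2 / (2 * η) + η / 2 * ∑ t, ‖g t‖ ^ 2 := by
  have h1 : ∀ t : Fin n, 2 * η * inner ℝ (g t) (x t.castSucc - v)
      ≤ (‖x t.castSucc - v‖ ^ 2 - ‖x t.succ - v‖ ^ 2) + η ^ 2 * ‖g t‖ ^ 2 := fun t => by
    have := pow_le_pow_left₀ (norm_nonneg _) (hstep t) 2
    rw [sub_right_comm, norm_sub_sq_real (x t.castSucc - v), inner_smul_right, norm_smul, mul_pow,
      Real.norm_eq_abs, sq_abs, real_inner_comm] at this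
    linarith
  have h2 := Finset.sum_le_sum fun t (_ : t ∈ Finset.univ) => h1 t
  rw [← Finset.mul_sum, Finset.sum_add_distrib, ← Finset.mul_sum, Finset.sum_sub_distrib] at h2
  -- Telescoping: peeling off the first and the last term of the same sum leaves `‖x 0 - v‖²` minus
  -- the final squared distance.
  have h3 := Fin.sum_univ_succ fun i => ‖x i - v‖ ^ 2
  have h4 := Fin.sum_univ_castSucc fun i => ‖x i - v‖ ^ 2
  have h5 := sq_nonneg ‖x (Fin.last n) - v‖
  have h6 : 2 * η * ∑ t, inner ℝ (g t) (x t.castSucc - v)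
      ≤ ‖x 0 - v‖ ^ 2 + η ^ 2 * ∑ t, ‖g t‖ ^ 2 := by linarith
  have : ‖x 0 - v‖ ^ 2 / (2 * η) + η / 2 * ∑ t, ‖g t‖ ^ 2
      = (‖x 0 - v‖ ^ 2 + η ^ 2 * ∑ t, ‖g t‖ ^ 2) / (2 * η) := by field_simp
  rw [this, le_div_iff₀ (by positivity)]
  linarith

/-! ### One round of the algorithm for regular losses -/

namespace Interaction.Regular

variable {d n : ℕ} {P : Interaction d n} {M L R : ℝ}

section Losses

variable (hP : P.Regular M L R)
include hP

lemma convexOn_loss (t : Fin n) : ConvexOn ℝ univ (P.loss t) := by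
  refine ⟨convex_univ, fun x _ y _ a b ha hb hab => ?_⟩
  obtain ⟨v, hv, -⟩ := hP.exists_subgradient t (a • x + b • y)
  have h1 := mul_le_mul_of_nonneg_left (hv x) ha
  have h2 := mul_le_mul_of_nonneg_left (hv y) hb
  have h3 : a * inner ℝ v (x - (a • x + b • y)) + b * inner ℝ v (y - (a • x + b • y)) = 0 := by
    rw [← inner_smul_right, ← inner_smul_right, ← inner_add_right]
    have : a • (x - (a • x + b • y)) + b • (y - (a • x + b • y))
        = (1 - (a + b)) • (a • x + b • y) := by module
    rw [this, hab]; simp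
  simp only [smul_eq_mul]
  have h4 : P.loss t (a • x + b • y)
    = a * P.loss t (a • x + b • y) + b * P.loss t (a • x + b • y) := by rw [← add_mul, hab, one_mul]
  linarith

lemma continuous_loss (t : Fin n) : Continuous (P.loss t) :=
  (hP.convexOn_loss t).locallyLipschitz.continuous

lemma loss_sub_le (t : Fin n) {β β' : Vec d} (hβ : β ∈ P.K) :
    P.loss t β - P.loss t β' ≤ L * ‖β - β'‖ := by
  obtain ⟨v, hv, hvL⟩ := hP.exists_subgradient t β
  have h1 := hv β'
  have h2 : inner ℝ v (β - β') ≤ L * ‖β - β'‖ :=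
    (real_inner_le_norm _ _).trans (by gcongr; exact hvL hβ)
  rw [← neg_sub β β', inner_neg_right] at h1
  linarith

lemma abs_loss_sub_le (t : Fin n) {β β' : Vec d} (hβ : β ∈ P.K) (hβ' : β' ∈ P.K) :
    |P.loss t β - P.loss t β'| ≤ L * ‖β - β'‖ := by
  rw [abs_sub_le_iff]
  exact ⟨hP.loss_sub_le t hβ, norm_sub_rev β β' ▸ hP.loss_sub_le t hβ'⟩

lemma zero_mem : (0 : Vec d) ∈ P.K := hP.ball_subset (by simp)

variable {δ : ℝ}

lemma shrunken_subset (h0 : 0 ≤ δ) (h1 : δ ≤ 1) : P.shrunken δ ⊆ P.K := by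
  rintro _ ⟨β, hβ, rfl⟩
  exact hP.convex.smul_mem_of_zero_mem hP.zero_mem hβ ⟨by linarith, by linarith⟩

lemma convex_shrunken : Convex ℝ (P.shrunken δ) := hP.convex.smul _

lemma isClosed_shrunken : IsClosed (P.shrunken δ) := by
  have hK : IsCompact P.K := (isCompact_closedBall (0 : Vec d) R).of_isClosed_subset hP.closed
    fun β hβ => by simpa using hP.norm_le β hβ
  exact (hK.image (continuous_const_smul _)).isClosed

lemma shrunken_nonempty : (P.shrunken δ).Nonempty := ⟨_, 0, hP.zero_mem, rfl⟩

/-- If `β = (1 - δ) k`, then `β + u` is the convex combination of `k` and `u / δ`, and the latter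
lies in the unit ball, hence in `K`. -/
lemma add_mem_of_mem_shrunken (h0 : 0 ≤ δ) (h1 : δ ≤ 1) {β u : Vec d} (hβ : β ∈ P.shrunken δ)
    (hu : ‖u‖ ≤ δ) : β + u ∈ P.K := by
  obtain ⟨k, hk, rfl⟩ := hβ
  rcases h0.eq_or_lt with rfl | h0
  · have : u = 0 := norm_le_zero_iff.1 hu
    simpa [this] using hk
  · have hu' : δ⁻¹ • u ∈ P.K := hP.ball_subset (by
      rw [mem_closedBall_zero_iff, norm_smul, norm_inv, Real.norm_of_nonneg h0.le,
        inv_mul_le_one₀ h0]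
      exact hu)
    have := hP.convex hk hu' (by linarith : 0 ≤ 1 - δ) h0.le (by ring)
    rwa [smul_inv_smul₀ h0.ne'] at this

/-- One round, conditionally on the iterate `β`: the loss gap is controlled by the linearized
gap for the gradient estimate. -/
lemma integral_gap_le (hd : 0 < d) (hL : 0 ≤ L) (t : Fin n) (h0 : 0 ≤ δ) (h1 : δ ≤ 1)
    (hpos : (P.agent t).y = -1 → 0 < δ)
    {β v : Vec d} (hβ : β ∈ P.shrunken δ) (hv : v ∈ P.shrunken δ) :
    ∫ u : USphere d, (P.loss t (β + δ • (u : Vec d)) - P.loss t v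
      - inner ℝ (P.gradEstimate δ t β u) (β - v)) ∂uniformSphere d ≤ 3 * L * δ := by
  have := isProbabilityMeasure_uniformSphere hd
  have hnorm : ∀ u : USphere d, ‖δ • (u : Vec d)‖ = δ := fun u => by
    rw [norm_smul, Real.norm_of_nonneg h0, norm_eq_of_mem_sphere, mul_one]
  have hmemK : ∀ u : USphere d, β + δ • (u : Vec d) ∈ P.K := fun u =>
    hP.add_mem_of_mem_shrunken h0 h1 hβ (hnorm u).le
  have hβK := hP.shrunken_subset h0 h1 hβ
  have hnear : ∀ u : USphere d, P.loss t (β + δ • (u : Vec d)) ≤ P.loss t β + L * δ := fun u => by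
    have := hP.loss_sub_le t (β' := β) (hmemK u)
    rw [add_sub_cancel_left, hnorm] at this
    linarith
  have hLδ : 0 ≤ L * δ := by positivity
  have hcont : Continuous fun u : USphere d => P.loss t (β + δ • (u : Vec d)) :=
    (hP.continuous_loss t).comp (by fun_prop)
  have hint1 : Integrable (fun u : USphere d => P.loss t (β + δ • (u : Vec d))) (uniformSphere d) :=
    Integrable.of_bound hcont.aestronglyMeasurable M (.of_forall fun u => by
      rw [Real.norm_of_nonneg (hP.loss_nonneg _ _)]; exact hP.loss_le t _ (hmemK u))
  rcases Int.units_eq_one_or (P.agent t).y with ht | ht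
  · simp only [gradEstimate, ht, if_true]
    have hsub := hP.sub_mem t ht β v
    rw [← neg_sub β v, inner_neg_right] at hsub
    calc _ ≤ ∫ _u : USphere d, 3 * L * δ ∂uniformSphere d := by
          refine integral_mono ((hint1.sub (integrable_const _)).sub (integrable_const _))
            (integrable_const _) fun u => ?_
          have := hnear u
          simp only
          linarith
      _ = _ := by simp
  · have hδ := hpos ht
    have hne : ((-1 : ℤˣ) = 1) = False := by simp
    simp only [gradEstimate, ht, hne, if_false]
    have hint2 : Integrable (fun u : USphere d =>
        P.loss t (β + δ • (u : Vec d)) * inner ℝ (u : Vec d) (v - β)) (uniformSphere d) :=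
      Integrable.of_bound (hcont.mul (by fun_prop)).aestronglyMeasurable (M * ‖v - β‖)
        (.of_forall fun u => by
          rw [norm_mul, Real.norm_of_nonneg (hP.loss_nonneg _ _)]
          refine mul_le_mul (hP.loss_le t _ (hmemK u)) ?_ (norm_nonneg _)
            ((hP.loss_nonneg t _).trans (hP.loss_le t _ (hmemK u)))
          refine (norm_inner_le_norm _ _).trans (le_of_eq ?_)
          rw [norm_eq_of_mem_sphere, one_mul])
    have hF : Continuous fun u : Vec d => P.loss t (β + u) :=
      (hP.continuous_loss t).comp (by fun_prop)
    have hFc : ConvexOn ℝ univ fun u : Vec d => P.loss t (β + u) := by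
      simpa [Function.comp_def] using (hP.convexOn_loss t).translate_right β
    -- The increment is `c (v + u) - c (β + u)`. Moving each point back to its centre costs at most
    -- `L δ`, whence `2 L δ`; the third `L δ` of the lemma comes from deploying `β + δ u` instead of
    -- `β`.
    have key := spherical_gradient_le hd hδ hFc hF (v - β)
      (C := P.loss t v - P.loss t β + 2 * L * δ) (L := L) (fun u hu => by
        have hu' : ‖u‖ ≤ δ := by simpa using hu
        have e : β + (u + (v - β)) = v + u := by abel
        rw [e]
        have a1 := hP.loss_sub_le t (β' := v) (hP.add_mem_of_mem_shrunken h0 h1 hv hu')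
        have a2 := hP.loss_sub_le t (β' := β + u) hβK
        rw [add_sub_cancel_left] at a1
        rw [sub_add_cancel_left, norm_neg] at a2
        have a3 : L * ‖u‖ ≤ L * δ := by gcongr
        linarith)
      (fun u hu u' hu' => by
        have := hP.abs_loss_sub_le t (hP.add_mem_of_mem_shrunken h0 h1 hβ
          (mem_closedBall_zero_iff.1 hu)) (hP.add_mem_of_mem_shrunken h0 h1 hβ
          (mem_closedBall_zero_iff.1 hu'))
        rwa [add_sub_add_left_eq_sub] at this)
    rw [← integral_const_mul] at key
    have hint3 := hint2.const_mul (d / δ)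
    calc _ ≤ ∫ u : USphere d, ((P.loss t β - P.loss t v + L * δ) +
            d / δ * (P.loss t (β + δ • (u : Vec d)) * inner ℝ (u : Vec d) (v - β)))
              ∂uniformSphere d := by
          have e : ∀ u : USphere d, inner ℝ ((d / δ * P.loss t (β + δ • (u : Vec d))) • (u : Vec d))
              (β - v) = -(d / δ * (P.loss t (β + δ • (u : Vec d)) *
                inner ℝ (u : Vec d) (v - β))) := fun u => by
            rw [← neg_sub v β, inner_neg_right, real_inner_smul_left]; ring
          simp only [e, sub_neg_eq_add]
          refine integral_mono ((hint1.sub (integrable_const _)).add hint3)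
            ((integrable_const _).add hint3) fun u => ?_
          have := hnear u
          simp only
          linarith
      _ ≤ 3 * L * δ := by
          rw [integral_add (integrable_const _) hint3]
          simp only [integral_const, probReal_univ, smul_eq_mul, one_mul]
          linarith

end Losses

end Interaction.Regular

/-! ### Iterates, the fraction of strategic rounds, and the parameters -/

namespace Interaction

variable {d n : ℕ} (P : Interaction d n)

lemma iterate_zero (M L R : ℝ) (β₁ : Vec d) (S : Fin n → USphere d) :
    P.iterate M L R β₁ S 0 = β₁ := rfl

lemma iterate_succ (M L R : ℝ) (β₁ : Vec d) (S : Fin n → USphere d) (t : Fin n) :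
    P.iterate M L R β₁ S t.succ = proj (P.shrunken (P.delta M L R))
      (P.iterate M L R β₁ S t.castSucc - P.eta M L R •
        P.gradEstimate (P.delta M L R) t (P.iterate M L R β₁ S t.castSucc) (S t)) :=
  Fin.induction_succ _ _ _

lemma iterate_congr {M L R : ℝ} {β₁ : Vec d} {S S' : Fin n → USphere d} (i : Fin (n + 1))
    (h : ∀ t : Fin n, t.castSucc < i → S t = S' t) :
    P.iterate M L R β₁ S i = P.iterate M L R β₁ S' i := by
  induction i using Fin.induction with
  | zero => rw [iterate_zero, iterate_zero]
  | succ t ih =>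
    rw [iterate_succ, iterate_succ, ih fun t' ht' => h t' (ht'.trans Fin.castSucc_lt_succ),
      h t Fin.castSucc_lt_succ]

/-- The iterate of round `t` uses only earlier directions, so it is independent of `S t`. -/
lemma iterate_update {M L R : ℝ} {β₁ : Vec d} (S : Fin n → USphere d) (t : Fin n) (u : USphere d) :
    P.iterate M L R β₁ (Function.update S t u) t.castSucc = P.iterate M L R β₁ S t.castSucc :=
  P.iterate_congr _ fun t' ht' =>
    Function.update_of_ne (fun h => by subst h; exact lt_irrefl _ ht') _ _

lemma theta_nonneg : 0 ≤ P.theta := by unfold theta; positivity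

lemma theta_le_one : P.theta ≤ 1 := by
  rw [theta]
  refine div_le_one_of_le₀ ?_ (by positivity)
  have := Finset.card_filter_le (Finset.univ : Finset (Fin n)) fun t => (P.agent t).y = -1
  rw [Finset.card_univ, Fintype.card_fin] at this
  exact_mod_cast this

lemma natCast_mul_theta (hn : 0 < n) :
    (n : ℝ) * P.theta = ((Finset.univ.filter fun t => (P.agent t).y = -1).card : ℝ) :=
  mul_div_cancel₀ _ (by positivity)

lemma sum_ite_label (hn : 0 < n) (a b : ℝ) :
    ∑ t, (if (P.agent t).y = -1 then a else b) = n * (P.theta * a + (1 - P.theta) * b) := by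
  have h1 := P.natCast_mul_theta hn
  have h2 := Finset.card_filter_add_card_filter_not (s := (Finset.univ : Finset (Fin n)))
    (fun t => (P.agent t).y = -1)
  rw [Finset.card_univ, Fintype.card_fin] at h2
  have h3 : ((Finset.univ.filter fun t => ¬ (P.agent t).y = -1).card : ℝ) = n - n * P.theta := by
    rw [h1, eq_sub_iff_add_eq']; exact_mod_cast h2
  rw [Finset.sum_ite, Finset.sum_const, Finset.sum_const, nsmul_eq_mul, nsmul_eq_mul, h3, ← h1]
  ring

lemma one_le_natCast_mul_theta (hn : 0 < n) {t : Fin n} (ht : (P.agent t).y = -1) :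
    1 ≤ n * P.theta := by
  rw [P.natCast_mul_theta hn]
  exact_mod_cast Finset.card_pos.2 ⟨t, by simpa using ht⟩

lemma theta_pos (hn : 0 < n) {t : Fin n} (ht : (P.agent t).y = -1) : 0 < P.theta := by
  have h1 := P.one_le_natCast_mul_theta hn ht
  by_contra h
  have : (n : ℝ) * P.theta ≤ 0 := mul_nonpos_of_nonneg_of_nonpos (by positivity) (not_lt.1 h)
  linarith

lemma exists_label_neg (h : 0 < P.theta) : ∃ t, (P.agent t).y = -1 := by
  by_contra! hne
  have : (Finset.univ.filter fun t => (P.agent t).y = -1) = ∅ := by simpa using hne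
  rw [theta, this] at h
  simp at h

section Parameters

variable {M L R : ℝ}

lemma delta_nonneg : 0 ≤ P.delta M L R := by
  have := P.theta_nonneg
  unfold delta; positivity

lemma delta_pos (hd : 0 < d) (hn : 0 < n) (hM : 0 < M) (hL : 0 < L) (hR : 0 < R)
    (hθ : 0 < P.theta) : 0 < P.delta M L R := by
  have h1 : (0 : ℝ) < d := by exact_mod_cast hd
  have h2 : (0 : ℝ) < n := by exact_mod_cast hn
  unfold delta; positivity

/-- The bound for the sum of the squared norms of the gradient estimates. -/
noncomputable def gradBudget (M L R : ℝ) : ℝ :=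
  n * (P.theta * (d ^ 2 * M ^ 2 / P.delta M L R ^ 2) + (1 - P.theta) * L ^ 2)

lemma gradBudget_pos (hd : 0 < d) (hn : 0 < n) (hM : 0 < M) (hL : 0 < L) (hR : 0 < R) :
    0 < P.gradBudget M L R := by
  have h1 : (0 : ℝ) < d := by exact_mod_cast hd
  have h2 : (0 : ℝ) < n := by exact_mod_cast hn
  have h3 := P.theta_le_one
  refine mul_pos h2 ?_
  rcases P.theta_nonneg.eq_or_lt with h | h
  · rw [← h]; positivity
  · have := P.delta_pos hd hn hM hL hR h
    have h4 : 0 ≤ (1 - P.theta) * L ^ 2 := mul_nonneg (by linarith) (by positivity)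
    have : 0 < P.theta * (d ^ 2 * M ^ 2 / P.delta M L R ^ 2) := by positivity
    linarith

end Parameters

end Interaction

/-! ### Expected regret for regular losses -/

namespace Interaction.Regular

variable {d n : ℕ} {P : Interaction d n} {M L R : ℝ}

section Algorithm

variable (hP : P.Regular M L R)
include hP

lemma iterate_mem {β₁ : Vec d} (hβ₁ : β₁ ∈ P.shrunken (P.delta M L R)) (S : Fin n → USphere d)
    (i : Fin (n + 1)) : P.iterate M L R β₁ S i ∈ P.shrunken (P.delta M L R) := by
  induction i using Fin.cases with
  | zero => exact hβ₁
  | succ t =>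
    rw [iterate_succ]
    exact (proj_spec hP.shrunken_nonempty hP.isClosed_shrunken _).1

lemma deployed_mem (hδ : P.delta M L R ≤ 1) {β₁ : Vec d}
    (hβ₁ : β₁ ∈ P.shrunken (P.delta M L R)) (S : Fin n → USphere d) (t : Fin n) :
    P.deployed M L R β₁ S t ∈ P.K := by
  refine hP.add_mem_of_mem_shrunken P.delta_nonneg hδ (hP.iterate_mem hβ₁ S _) (le_of_eq ?_)
  rw [norm_smul, Real.norm_of_nonneg P.delta_nonneg, norm_eq_of_mem_sphere, mul_one]

lemma measurable_gradEstimate (δ : ℝ) (t : Fin n) :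
    Measurable fun x : Vec d × USphere d => P.gradEstimate δ t x.1 x.2 := by
  unfold gradEstimate
  split_ifs with ht
  · exact (hP.sub_measurable t ht).comp measurable_fst
  · have h1 : Measurable fun x : Vec d × USphere d => (x.2 : Vec d) :=
      measurable_subtype_coe.comp measurable_snd
    have h2 : Measurable fun x : Vec d × USphere d => P.loss t (x.1 + δ • (x.2 : Vec d)) :=
      (hP.continuous_loss t).measurable.comp (measurable_fst.add (h1.const_smul δ))
    exact (h2.const_mul _).smul h1

lemma measurable_iterate (β₁ : Vec d) (i : Fin (n + 1)) :
    Measurable fun S => P.iterate M L R β₁ S i := by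
  induction i using Fin.induction with
  | zero => exact measurable_const
  | succ t ih =>
    simp only [iterate_succ]
    refine (continuous_proj hP.convex_shrunken hP.shrunken_nonempty
      hP.isClosed_shrunken).measurable.comp (ih.sub ?_)
    exact ((hP.measurable_gradEstimate _ t).comp (ih.prodMk (measurable_pi_apply t))).const_smul
      (P.eta M L R)

lemma measurable_loss_deployed (β₁ : Vec d) (t : Fin n) :
    Measurable fun S => P.loss t (P.deployed M L R β₁ S t) :=
  have h : Measurable fun S : Fin n → USphere d => (S t : Vec d) :=
    measurable_subtype_coe.comp (measurable_pi_apply t)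
  (hP.continuous_loss t).measurable.comp ((hP.measurable_iterate β₁ _).add
    (h.const_smul (P.delta M L R)))

lemma norm_gradEstimate_sq_le (hδ : P.delta M L R ≤ 1) (t : Fin n) {β : Vec d}
    (hβ : β ∈ P.shrunken (P.delta M L R)) (u : USphere d) :
    ‖P.gradEstimate (P.delta M L R) t β u‖ ^ 2 ≤
      if (P.agent t).y = -1 then d ^ 2 * M ^ 2 / P.delta M L R ^ 2 else L ^ 2 := by
  rcases Int.units_eq_one_or (P.agent t).y with ht | ht
  · have hne : ((1 : ℤˣ) = -1) = False := by simp
    simp only [gradEstimate, ht, if_true, hne, if_false]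
    gcongr
    exact hP.norm_sub_le t ht β
  · have hne : ((-1 : ℤˣ) = 1) = False := by simp
    simp only [gradEstimate, ht, if_true, hne, if_false]
    have h0 := hP.loss_nonneg t (β + P.delta M L R • (u : Vec d))
    have h1 := hP.loss_le t (β + P.delta M L R • (u : Vec d))
      (hP.add_mem_of_mem_shrunken P.delta_nonneg hδ hβ (le_of_eq (by
        rw [norm_smul, Real.norm_of_nonneg P.delta_nonneg, norm_eq_of_mem_sphere, mul_one])))
    have h2 := P.delta_nonneg (M := M) (L := L) (R := R)
    rw [norm_smul, norm_eq_of_mem_sphere, mul_one, Real.norm_of_nonneg (by positivity), mul_pow,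
      div_pow, mul_div_right_comm]
    gcongr

/-- The pathwise bound on the linearized regret. -/
lemma sum_inner_gradEstimate_le (hd : 0 < d) (hn : 0 < n) (hM : 0 < M) (hL : 0 < L) (hR : 0 < R)
    (hδ : P.delta M L R ≤ 1) {β₁ v : Vec d} (hβ₁ : β₁ ∈ P.shrunken (P.delta M L R))
    (hv : v ∈ P.shrunken (P.delta M L R)) (S : Fin n → USphere d) :
    ∑ t, inner ℝ (P.gradEstimate (P.delta M L R) t (P.iterate M L R β₁ S t.castSucc) (S t))
        (P.iterate M L R β₁ S t.castSucc - v)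
      ≤ 5 / 2 * R * √(P.gradBudget M L R) := by
  have hQ := P.gradBudget_pos hd hn hM hL hR
  set Q := P.gradBudget M L R with hQdef
  have hsq : 0 < √Q := Real.sqrt_pos.2 hQ
  have hη : P.eta M L R = R / √Q := rfl
  have hηpos : 0 < P.eta M L R := by rw [hη]; positivity
  refine (sum_inner_le_of_step hηpos (P.iterate M L R β₁ S) _ v fun t => ?_).trans ?_
  · rw [iterate_succ]
    exact norm_proj_sub_le hP.convex_shrunken hP.shrunken_nonempty hP.isClosed_shrunken _ hv
  have hsum : ∑ t, ‖P.gradEstimate (P.delta M L R) t (P.iterate M L R β₁ S t.castSucc) (S t)‖ ^ 2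
      ≤ Q := by
    refine (Finset.sum_le_sum fun t _ =>
      hP.norm_gradEstimate_sq_le hδ t (hP.iterate_mem hβ₁ S _) (S t)).trans (le_of_eq ?_)
    exact P.sum_ite_label hn _ _
  have hdist : ‖P.iterate M L R β₁ S 0 - v‖ ^ 2 ≤ (2 * R) ^ 2 := by
    have hsub := hP.shrunken_subset P.delta_nonneg hδ
    have h1 := hP.norm_le _ (hsub hβ₁)
    have h2 := hP.norm_le _ (hsub hv)
    rw [iterate_zero]
    gcongr
    linarith [_root_.norm_sub_le β₁ v]
  -- With `η = R / √Q` the two terms are `2 R √Q` and `R √Q / 2`.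
  calc _ ≤ (2 * R) ^ 2 / (2 * P.eta M L R) + P.eta M L R / 2 * Q := by gcongr
    _ = 5 / 2 * R * √Q := by
      have hQ2 : Q = √Q * √Q := (Real.mul_self_sqrt hQ.le).symm
      rw [hη]
      nth_rw 3 [hQ2]
      field_simp
      ring

/-- With the other directions frozen the iterate is constant and `S t` is still uniform, so
`integral_gap_le` applies conditionally. The crude uniform bound in the proof serves only
integrability. -/
lemma integral_round_le (hd : 0 < d) (hn : 0 < n) (hM : 0 < M) (hL : 0 < L) (hR : 0 < R)
    (hδ : P.delta M L R ≤ 1) {β₁ v : Vec d} (hβ₁ : β₁ ∈ P.shrunken (P.delta M L R))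
    (hv : v ∈ P.shrunken (P.delta M L R)) (t : Fin n) :
    Integrable (fun S => P.loss t (P.deployed M L R β₁ S t) - P.loss t v
      - inner ℝ (P.gradEstimate (P.delta M L R) t (P.iterate M L R β₁ S t.castSucc) (S t))
        (P.iterate M L R β₁ S t.castSucc - v)) (Measure.pi fun _ => uniformSphere d) ∧
    ∫ S, (P.loss t (P.deployed M L R β₁ S t) - P.loss t v
      - inner ℝ (P.gradEstimate (P.delta M L R) t (P.iterate M L R β₁ S t.castSucc) (S t))
        (P.iterate M L R β₁ S t.castSucc - v)) ∂(Measure.pi fun _ => uniformSphere d)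
      ≤ 3 * L * P.delta M L R := by
  have := isProbabilityMeasure_uniformSphere hd
  set δ := P.delta M L R with hδdef
  have hδ0 : 0 ≤ δ := P.delta_nonneg
  set H : Vec d → USphere d → ℝ := fun β u =>
    P.loss t (β + δ • (u : Vec d)) - P.loss t v - inner ℝ (P.gradEstimate δ t β u) (β - v) with hH
  have hHm : Measurable (Function.uncurry H) := by
    have h1 : Measurable fun x : Vec d × USphere d => (x.2 : Vec d) :=
      measurable_subtype_coe.comp measurable_snd
    refine Measurable.sub (Measurable.sub ?_ measurable_const) ?_
    · exact (hP.continuous_loss t).measurable.comp (measurable_fst.add (h1.const_smul δ))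
    · exact (hP.measurable_gradEstimate δ t).inner (measurable_fst.sub measurable_const)
  have hvK := hP.shrunken_subset hδ0 hδ hv
  have hbound : ∀ β ∈ P.shrunken δ, ∀ u,
      |H β u| ≤ M + M + ((1 + max (d ^ 2 * M ^ 2 / δ ^ 2) (L ^ 2))) * (R + R) := by
    intro β hβ u
    have hβK := hP.shrunken_subset hδ0 hδ hβ
    have hmem : β + δ • (u : Vec d) ∈ P.K := hP.add_mem_of_mem_shrunken hδ0 hδ hβ (le_of_eq (by
      rw [norm_smul, Real.norm_of_nonneg hδ0, norm_eq_of_mem_sphere, mul_one]))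
    have a1 : |P.loss t (β + δ • (u : Vec d))| ≤ M := by
      rw [abs_of_nonneg (hP.loss_nonneg _ _)]; exact hP.loss_le t _ hmem
    have a2 : |P.loss t v| ≤ M := by
      rw [abs_of_nonneg (hP.loss_nonneg _ _)]; exact hP.loss_le t _ hvK
    have a3 : ‖P.gradEstimate δ t β u‖ ≤ 1 + max (d ^ 2 * M ^ 2 / δ ^ 2) (L ^ 2) := by
      have h1 := hP.norm_gradEstimate_sq_le hδ t hβ u
      have h2 : (if (P.agent t).y = -1 then d ^ 2 * M ^ 2 / P.delta M L R ^ 2 else L ^ 2)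
          ≤ max (d ^ 2 * M ^ 2 / δ ^ 2) (L ^ 2) := by
        split_ifs
        exacts [le_max_left _ _, le_max_right _ _]
      nlinarith [sq_nonneg (‖P.gradEstimate δ t β u‖ - 1)]
    have a4 : ‖β - v‖ ≤ R + R :=
      (_root_.norm_sub_le _ _).trans (add_le_add (hP.norm_le β hβK) (hP.norm_le v hvK))
    have a5 : |inner ℝ (P.gradEstimate δ t β u) (β - v)|
        ≤ (1 + max (d ^ 2 * M ^ 2 / δ ^ 2) (L ^ 2)) * (R + R) :=
      (abs_real_inner_le_norm _ _).trans (mul_le_mul a3 a4 (norm_nonneg _)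
        ((norm_nonneg _).trans a3))
    exact (abs_sub _ _).trans (add_le_add ((abs_sub _ _).trans (add_le_add a1 a2)) a5)
  have hX := hP.measurable_iterate β₁ t.castSucc
  refine ⟨?_, ?_⟩
  · refine Integrable.of_bound (hHm.comp (hX.prodMk (measurable_pi_apply t))).aestronglyMeasurable
      _ (.of_forall fun S => hbound _ (hP.iterate_mem hβ₁ S t.castSucc) (S t))
  · refine integral_le_of_fresh_coordinate (uniformSphere d) t hX
      (fun S u => P.iterate_update S t u) hHm
      (fun S u => hbound _ (hP.iterate_mem hβ₁ S t.castSucc) u) fun S => ?_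
    exact hP.integral_gap_le hd hL.le t hδ0 hδ
      (fun ht => P.delta_pos hd hn hM hL hR (P.theta_pos hn ht))
      (hP.iterate_mem hβ₁ S t.castSucc) hv

/-- The expected regret of the algorithm on a regular interaction. -/
theorem expectedRegretLE (hd : 0 < d) (hn : 0 < n) (hM : 0 < M) (hL : 0 < L) (hR : 0 < R)
    (hδ : P.delta M L R ≤ 1) :
    P.ExpectedRegretLE M L R
      (5 / 2 * R * √(P.gradBudget M L R) + (R + 3) * (n * L * P.delta M L R)) := by
  intro β₁ hβ₁
  have := isProbabilityMeasure_uniformSphere hd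
  set δ := P.delta M L R with hδdef
  have hδ0 : 0 ≤ δ := P.delta_nonneg
  have hint : ∀ t, Integrable (fun S => P.loss t (P.deployed M L R β₁ S t))
      (Measure.pi fun _ => uniformSphere d) := fun t =>
    Integrable.of_bound (hP.measurable_loss_deployed β₁ t).aestronglyMeasurable M
      (.of_forall fun S => by
        rw [Real.norm_of_nonneg (hP.loss_nonneg _ _)]
        exact hP.loss_le t _ (hP.deployed_mem hδ hβ₁ S t))
  have hintsum := integrable_finsetSum Finset.univ fun t _ => hint t
  refine ⟨hintsum.sub (integrable_const _), ?_⟩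
  unfold stackelbergRegret
  rw [integral_sub hintsum (integrable_const _)]
  simp only [integral_const, probReal_univ, smul_eq_mul, one_mul]
  rw [sub_le_comm]
  refine le_csInf (hP.shrunken_nonempty (δ := 0) |>.mono
    (hP.shrunken_subset le_rfl zero_le_one) |>.image _) ?_
  rintro _ ⟨β, hβ, rfl⟩
  -- The iterates stay in `K_δ`, so descent is compared with the shrunken copy of `β`, at a cost of
  -- `R L δ` per round.
  set v := (1 - δ) • β with hvdef
  have hv : v ∈ P.shrunken δ := ⟨β, hβ, rfl⟩
  have hvK := hP.shrunken_subset hδ0 hδ hv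
  have hcomp : ∀ t, P.loss t v - P.loss t β ≤ R * (L * δ) := fun t => by
    refine (hP.loss_sub_le t (β' := β) hvK).trans ?_
    have e : v - β = -(δ • β) := by rw [hvdef]; module
    rw [e, norm_neg, norm_smul, Real.norm_of_nonneg hδ0]
    have := mul_le_mul_of_nonneg_left (hP.norm_le β hβ) (mul_nonneg hL.le hδ0)
    linarith
  have hround := fun t => hP.integral_round_le hd hn hM hL hR hδ hβ₁ hv t
  set G : Fin n → (Fin n → USphere d) → ℝ := fun t S =>
    inner ℝ (P.gradEstimate δ t (P.iterate M L R β₁ S t.castSucc) (S t))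
        (P.iterate M L R β₁ S t.castSucc - v) with hG
  have hpath : ∀ S, ∑ t, P.loss t (P.deployed M L R β₁ S t)
      ≤ ∑ t, (P.loss t (P.deployed M L R β₁ S t) - P.loss t v - G t S)
        + (∑ t, P.loss t β + n * (R * (L * δ)) + 5 / 2 * R * √(P.gradBudget M L R)) := by
    intro S
    have h1 := hP.sum_inner_gradEstimate_le hd hn hM hL hR hδ hβ₁ hv S
    have h2 := Finset.sum_le_sum fun t (_ : t ∈ Finset.univ) => hcomp t
    rw [Finset.sum_sub_distrib] at h2
    simp only [Finset.sum_const, Finset.card_univ, Fintype.card_fin, nsmul_eq_mul] at h2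
    rw [Finset.sum_sub_distrib, Finset.sum_sub_distrib]
    simp only [hG]
    linarith
  have hGint := integrable_finsetSum Finset.univ fun t _ => (hround t).1
  have hE := integral_mono hintsum (hGint.add (integrable_const _)) hpath
  rw [integral_add' hGint (integrable_const _), integral_finsetSum _ fun t _ => (hround t).1] at hE
  have hsum := Finset.sum_le_sum fun t (_ : t ∈ Finset.univ) => (hround t).2
  simp only [integral_const, probReal_univ, smul_eq_mul, one_mul, Finset.sum_const,
    Finset.card_univ, Fintype.card_fin, nsmul_eq_mul] at hE hsum
  linarith

end Algorithm

end Interaction.Regular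

/-! ### From the regret bound to rates in `n` and `d` -/

section Rates

lemma Interaction.ExpectedRegretLE.mono {d n : ℕ} {P : Interaction d n} {M L R b b' : ℝ}
    (h : P.ExpectedRegretLE M L R b) (hb : b ≤ b') : P.ExpectedRegretLE M L R b' :=
  fun β₁ hβ₁ => ⟨(h β₁ hβ₁).1, (h β₁ hβ₁).2.trans hb⟩

/-- The choice of `δ` balances the variance and the bias of the gradient estimates. -/
lemma Interaction.regret_rate_le {d n : ℕ} (P : Interaction d n) {M L R : ℝ} (hd : 0 < d)
    (hn : 0 < n) (hM : 0 < M) (hL : 0 < L) (hR : 0 < R) :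
    5 / 2 * R * √(P.gradBudget M L R) + (R + 3) * (n * L * P.delta M L R)
      ≤ 7 / 2 * (P.theta ^ (1 / 4 : ℝ) * (n : ℝ) ^ (3 / 4 : ℝ) * √(d * (M * L * (R * (R + 3)))))
        + 5 / 2 * R * L * √n := by
  have hd' : (0 : ℝ) < d := by exact_mod_cast hd
  have hn' : (0 : ℝ) < n := by exact_mod_cast hn
  have hθ0 := P.theta_nonneg
  set δ := P.delta M L R with hδ
  have hδ0 : 0 ≤ δ := P.delta_nonneg
  set T := P.theta ^ (1 / 4 : ℝ) * (n : ℝ) ^ (3 / 4 : ℝ) * √(d * (M * L * (R * (R + 3)))) with hT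
  have hT0 : 0 ≤ T := by positivity
  -- Bias and variance meet at the common value `T`: the bias equals it, and so does the bandit term
  -- below when `θ > 0`. The total is therefore `(1 + 5/2) T`, plus the gradient term.
  have hbias : (R + 3) * (n * L * δ) = T := by
    have e1 : (n : ℝ) * (n : ℝ) ^ (-(1 / 4) : ℝ) = (n : ℝ) ^ (3 / 4 : ℝ) := by
      rw [mul_comm, ← Real.rpow_add_one hn'.ne']; norm_num
    have e2 : (R + 3) * L * √(d * M * R / (L * (R + 3))) = √(d * (M * L * (R * (R + 3)))) := by
      symm
      rw [Real.sqrt_eq_iff_mul_self_eq (by positivity) (by positivity)]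
      have := Real.mul_self_sqrt (by positivity : 0 ≤ d * M * R / (L * (R + 3)))
      symm
      calc _ = ((R + 3) * L) ^ 2 * (√(d * M * R / (L * (R + 3))) *
            √(d * M * R / (L * (R + 3)))) := by ring
        _ = _ := by rw [this]; field_simp
    rw [hT, ← e1, ← e2, hδ, Interaction.delta]
    ring
  have hvar : R * (√(n * P.theta) * (d * M / δ)) ≤ T := by
    rcases hθ0.eq_or_lt with h | h
    · rw [← h]; simpa using hT0
    · have hδpos : 0 < δ := P.delta_pos hd hn hM hL hR h
      have e : R * (√(n * P.theta) * (d * M / δ)) = R * √(n * P.theta) * (d * M) / δ := by ring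
      rw [e, div_le_iff₀ hδpos]
      refine le_of_eq ?_
      have e1 : P.theta ^ (1 / 4 : ℝ) * P.theta ^ (1 / 4 : ℝ) = √P.theta := by
        rw [← Real.rpow_add h, Real.sqrt_eq_rpow]; norm_num
      have e2 : (n : ℝ) ^ (3 / 4 : ℝ) * (n : ℝ) ^ (-(1 / 4) : ℝ) = √n := by
        rw [← Real.rpow_add hn', Real.sqrt_eq_rpow]; norm_num
      have e3 : √(d * (M * L * (R * (R + 3)))) * √(d * M * R / (L * (R + 3))) = d * M * R := by
        rw [← Real.sqrt_mul (by positivity), Real.sqrt_eq_iff_mul_self_eq (by positivity)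
          (by positivity)]
        field_simp
      rw [Real.sqrt_mul hn'.le, hT, hδ, Interaction.delta, ← e1, ← e2]
      calc _ = P.theta ^ (1 / 4 : ℝ) * P.theta ^ (1 / 4 : ℝ) *
            ((n : ℝ) ^ (3 / 4 : ℝ) * (n : ℝ) ^ (-(1 / 4) : ℝ)) * (d * M * R) := by ring
        _ = P.theta ^ (1 / 4 : ℝ) * P.theta ^ (1 / 4 : ℝ) *
            ((n : ℝ) ^ (3 / 4 : ℝ) * (n : ℝ) ^ (-(1 / 4) : ℝ)) *
            (√(d * (M * L * (R * (R + 3)))) * √(d * M * R / (L * (R + 3)))) := by rw [e3]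
        _ = _ := by ring
  have hQ : √(P.gradBudget M L R) ≤ √(n * P.theta) * (d * M / δ) + √n * L := by
    rw [Real.sqrt_le_iff]
    refine ⟨by positivity, ?_⟩
    have e1 : (√(n * P.theta) * (d * M / δ)) ^ 2 = n * P.theta * (d ^ 2 * M ^ 2 / δ ^ 2) := by
      rw [mul_pow, Real.sq_sqrt (by positivity), div_pow, mul_pow]
    have e2 : (√n * L) ^ 2 = n * L ^ 2 := by rw [mul_pow, Real.sq_sqrt hn'.le]
    have e3 : 0 ≤ (√(n * P.theta) * (d * M / δ)) * (√n * L) := by positivity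
    have e4 : 0 ≤ n * (P.theta * L ^ 2) := by positivity
    rw [Interaction.gradBudget, add_sq, e1, e2]
    linarith
  rw [hbias]
  have := mul_le_mul_of_nonneg_left hQ hR.le
  linarith

variable {d n : ℕ} {P : Interaction d n} {R₁ R₂ ε r s κ : ℝ} {p q : ℝ≥0∞}

lemma dimExponent_nonneg (s : ℝ) (q : ℝ≥0∞) : 0 ≤ dimExponent s q := le_max_right _ _

lemma dimExponent_eq_zero (hs : 0 < s) (hpq : p.HolderConjugate q) (hp : p ≤ 2) :
    dimExponent s q = 0 := by
  have hpi : p⁻¹ ≠ ⊤ := by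
    simpa using (zero_lt_one.trans_le hpq.one_le).ne'
  have hqi : q⁻¹ ≠ ⊤ := by
    simpa using (zero_lt_one.trans_le hpq.symm.one_le).ne'
  have hsum : (p⁻¹).toReal + (q⁻¹).toReal = 1 := by
    rw [← ENNReal.toReal_add hpi hqi, hpq.inv_add_inv_eq_one]; simp
  have h2 : (1 / 2 : ℝ) ≤ (p⁻¹).toReal := by
    simpa using ENNReal.toReal_mono hpi (ENNReal.inv_le_inv.2 hp)
  refine max_eq_right ?_
  nlinarith

lemma lossBound_pos (hR₁ : 0 < R₁) (hR₂ : 0 < R₂) (hκ : 0 ≤ κ) : 0 < lossBound R₁ R₂ s κ := by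
  unfold lossBound; positivity

lemma lossLip_pos (hR₁ : 0 < R₁) (hR₂ : 0 < R₂) (hs : 0 < s) (hκ : 0 ≤ κ) :
    0 < lossLip R₁ R₂ s κ := by
  unfold lossLip; positivity

lemma lossBound_mul_le (hR₁ : 0 < R₁) (hR₂ : 0 < R₂) {x : ℝ} (hx : 1 ≤ x) :
    lossBound R₁ R₂ s (κ * x) ≤ lossBound R₁ R₂ s κ * x := by
  have : (1 + R₁ * R₂) * 1 ≤ (1 + R₁ * R₂) * x := by gcongr
  unfold lossBound
  linarith

lemma lossLip_mul_le (hR₁ : 0 < R₁) {x : ℝ} (hx : 1 ≤ x) :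
    lossLip R₁ R₂ s (κ * x) ≤ lossLip R₁ R₂ s κ * x := by
  have : R₁ * 1 ≤ R₁ * x := by gcongr
  unfold lossLip
  linarith

/-- The factor of `θ^{1/4} n^{3/4} d^{a+1/2}` in the regret bound. -/
noncomputable def banditConst (R₁ R₂ ε s : ℝ) : ℝ :=
  7 / 2 * √(lossBound R₁ R₂ s (ε ^ (-s)) * lossLip R₁ R₂ s (ε ^ (-s)) * (R₂ * (R₂ + 3)))

/-- The factor of `d^a √n` in the regret bound. -/
noncomputable def gradientConst (R₁ R₂ ε s : ℝ) : ℝ :=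
  5 / 2 * R₂ * lossLip R₁ R₂ s (ε ^ (-s))

lemma banditConst_nonneg (R₁ R₂ ε s : ℝ) : 0 ≤ banditConst R₁ R₂ ε s := by
  unfold banditConst; positivity

lemma gradientConst_nonneg (hR₁ : 0 < R₁) (hR₂ : 0 < R₂) (hε : 0 < ε) (hs : 0 < s) :
    0 ≤ gradientConst R₁ R₂ ε s := by
  have := lossLip_pos hR₁ hR₂ hs (by positivity : 0 ≤ ε ^ (-s))
  unfold gradientConst; positivity

namespace Interaction.Admissible

/-- Here `δ = 0` and the constraint on `κ` is vacuous, so any `κ ≥ 0` is admissible: both `κ = 0`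
and `costFactor` are used. -/
lemma expectedRegretLE_of_theta_eq_zero (hP : P.Admissible R₁ R₂ ε r p)
    (hrs : r.HolderConjugate s) (hε : 0 < ε) (hd : 0 < d) (hn : 0 < n)
    (hpq : p.HolderConjugate q) (hR₁ : 0 < R₁) (hR₂ : 0 < R₂) (hκ : 0 ≤ κ) (hθ : P.theta = 0) :
    P.ExpectedRegretLE (lossBound R₁ R₂ s κ) (lossLip R₁ R₂ s κ) R₂
      (5 / 2 * R₂ * lossLip R₁ R₂ s κ * √n) := by
  have hM := lossBound_pos (s := s) hR₁ hR₂ hκ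
  have hL := lossLip_pos hR₁ hR₂ hrs.symm.pos hκ
  have hδ : P.delta (lossBound R₁ R₂ s κ) (lossLip R₁ R₂ s κ) R₂ ≤ 1 := by
    rw [delta, hθ]; norm_num
  refine ((hP.regular hrs hε hd hpq hR₁ hR₂ hκ fun t ht =>
    absurd (P.theta_pos hn ht) (by simp [hθ])).expectedRegretLE hd hn hM hL hR₂ hδ).mono ?_
  refine (P.regret_rate_le hd hn hM hL hR₂).trans (le_of_eq ?_)
  rw [hθ, Real.zero_rpow (by norm_num)]
  ring

/-- Both `M` and `L` are at most `d ^ a` times their values at `κ = ε ^ (-s)`, so `√(d M L)`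
contributes `d ^ (a + 1/2)`. -/
lemma expectedRegretLE (hP : P.Admissible R₁ R₂ ε r p)
    (hrs : r.HolderConjugate s) (hε : 0 < ε) (hd : 0 < d) (hn : 0 < n)
    (hpq : p.HolderConjugate q) (hR₁ : 0 < R₁) (hR₂ : 0 < R₂)
    (hδ : P.delta (lossBound R₁ R₂ s (costFactor ε s q d))
        (lossLip R₁ R₂ s (costFactor ε s q d)) R₂ ≤ 1) :
    P.ExpectedRegretLE (lossBound R₁ R₂ s (costFactor ε s q d))
      (lossLip R₁ R₂ s (costFactor ε s q d)) R₂
      (banditConst R₁ R₂ ε s * (P.theta ^ (1 / 4 : ℝ) * (n : ℝ) ^ (3 / 4 : ℝ)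
          * (d : ℝ) ^ (dimExponent s q + 1 / 2))
        + gradientConst R₁ R₂ ε s * ((d : ℝ) ^ dimExponent s q * √n)) := by
  have hκ := costFactor_nonneg (s := s) hε q d
  have hs := hrs.symm.pos
  have hM := lossBound_pos (s := s) hR₁ hR₂ hκ
  have hL := lossLip_pos hR₁ hR₂ hs hκ
  have hθ := P.theta_nonneg
  refine ((hP.regular hrs hε hd hpq hR₁ hR₂ hκ fun t ht => le_rfl).expectedRegretLE
    hd hn hM hL hR₂ hδ).mono ((P.regret_rate_le hd hn hM hL hR₂).trans ?_)
  have hd' : (0 : ℝ) < d := by exact_mod_cast hd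
  set x := (d : ℝ) ^ dimExponent s q with hx
  have hx1 : 1 ≤ x := Real.one_le_rpow (by exact_mod_cast hd) (dimExponent_nonneg s q)
  have hκeq : costFactor ε s q d = ε ^ (-s) * x := rfl
  have hε' : 0 ≤ ε ^ (-s) := by positivity
  have hM' := lossBound_mul_le (s := s) (κ := ε ^ (-s)) hR₁ hR₂ hx1
  have hL' := lossLip_mul_le (R₂ := R₂) (s := s) (κ := ε ^ (-s)) hR₁ hx1
  rw [← hκeq] at hM' hL'
  have hM₀ := lossBound_pos (s := s) hR₁ hR₂ hε'
  have hL₀ := lossLip_pos hR₁ hR₂ hs hε'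
  have hsqrt : √(d * (lossBound R₁ R₂ s (costFactor ε s q d) *
      lossLip R₁ R₂ s (costFactor ε s q d) * (R₂ * (R₂ + 3))))
      ≤ (d : ℝ) ^ (dimExponent s q + 1 / 2) *
        √(lossBound R₁ R₂ s (ε ^ (-s)) * lossLip R₁ R₂ s (ε ^ (-s)) * (R₂ * (R₂ + 3))) := by
    rw [Real.rpow_add hd', ← Real.sqrt_eq_rpow, ← hx]
    have e : x * √d * √(lossBound R₁ R₂ s (ε ^ (-s)) * lossLip R₁ R₂ s (ε ^ (-s)) *
        (R₂ * (R₂ + 3))) = √(d * ((lossBound R₁ R₂ s (ε ^ (-s)) * x) *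
          (lossLip R₁ R₂ s (ε ^ (-s)) * x) * (R₂ * (R₂ + 3)))) := by
      rw [show d * ((lossBound R₁ R₂ s (ε ^ (-s)) * x) *
          (lossLip R₁ R₂ s (ε ^ (-s)) * x) * (R₂ * (R₂ + 3))) = x ^ 2 * (d *
          (lossBound R₁ R₂ s (ε ^ (-s)) * lossLip R₁ R₂ s (ε ^ (-s)) * (R₂ * (R₂ + 3)))) by ring,
        Real.sqrt_mul (sq_nonneg x), Real.sqrt_sq (by positivity), Real.sqrt_mul hd'.le, mul_assoc]
    rw [e]
    exact Real.sqrt_le_sqrt (by gcongr)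
  have h1 := mul_le_mul_of_nonneg_left hsqrt
    (by positivity : 0 ≤ P.theta ^ (1 / 4 : ℝ) * (n : ℝ) ^ (3 / 4 : ℝ))
  have h2 := mul_le_mul_of_nonneg_left hL' (by positivity : 0 ≤ 5 / 2 * R₂ * √n)
  rw [banditConst, gradientConst]
  linarith

/-- The regret bound when `θ^{1/4}` and `√n` are dominated by multiples of a common rate. -/
lemma expectedRegretLE_of_rate (hP : P.Admissible R₁ R₂ ε r p)
    (hrs : r.HolderConjugate s) (hε : 0 < ε) (hd : 0 < d) (hn : 0 < n)
    (hpq : p.HolderConjugate q) (hR₁ : 0 < R₁) (hR₂ : 0 < R₂)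
    (hδ : P.delta (lossBound R₁ R₂ s (costFactor ε s q d))
        (lossLip R₁ R₂ s (costFactor ε s q d)) R₂ ≤ 1) {c₁ c₂ N : ℝ}
    (h₁ : P.theta ^ (1 / 4 : ℝ) * (n : ℝ) ^ (3 / 4 : ℝ) ≤ c₁ * N) (h₂ : √n ≤ c₂ * N) :
    P.ExpectedRegretLE (lossBound R₁ R₂ s (costFactor ε s q d))
      (lossLip R₁ R₂ s (costFactor ε s q d)) R₂
      ((banditConst R₁ R₂ ε s * c₁ + gradientConst R₁ R₂ ε s * c₂)
        * (N * (d : ℝ) ^ (dimExponent s q + 1 / 2))) := by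
  refine (hP.expectedRegretLE hrs hε hd hn hpq hR₁ hR₂ hδ).mono ?_
  have hd1 : (1 : ℝ) ≤ d := by exact_mod_cast hd
  have hC0 := banditConst_nonneg R₁ R₂ ε s
  have hC1 := gradientConst_nonneg hR₁ hR₂ hε hrs.symm.pos
  have hpow : (d : ℝ) ^ dimExponent s q ≤ (d : ℝ) ^ (dimExponent s q + 1 / 2) :=
    Real.rpow_le_rpow_of_exponent_le hd1 (by linarith)
  calc _ ≤ banditConst R₁ R₂ ε s * (c₁ * N * (d : ℝ) ^ (dimExponent s q + 1 / 2))
        + gradientConst R₁ R₂ ε s * ((d : ℝ) ^ (dimExponent s q + 1 / 2) * (c₂ * N)) := by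
        gcongr
    _ = _ := by ring

end Interaction.Admissible

/-- For `γ ≤ 1` the exponent `(3 - γ) / 4` is at least `1/2`. Otherwise a single strategic round
forces `1 ≤ n θ ≤ c n ^ (1 - γ)`, and the fourth root of this bound makes up the missing power of
`n`. -/
lemma sqrt_natCast_le_rpow {n : ℕ} (hn : 0 < n) {θ c γ : ℝ} (hc : 0 < c)
    (hθ : θ ≤ c * (n : ℝ) ^ (-γ)) (h : γ ≤ 1 ∨ 1 ≤ n * θ) :
    √n ≤ (1 + c ^ (1 / 4 : ℝ)) * (n : ℝ) ^ ((3 - γ) / 4) := by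
  have hn1 : (1 : ℝ) ≤ n := by exact_mod_cast hn
  have hn0 : (0 : ℝ) < n := by linarith
  have hN : 0 ≤ (n : ℝ) ^ ((3 - γ) / 4) := by positivity
  have hc4 : 0 ≤ c ^ (1 / 4 : ℝ) := by positivity
  rw [Real.sqrt_eq_rpow]
  rcases h with h | h
  · have h1 : (n : ℝ) ^ (1 / 2 : ℝ) ≤ (n : ℝ) ^ ((3 - γ) / 4) :=
      Real.rpow_le_rpow_of_exponent_le hn1 (by linarith)
    nlinarith [mul_nonneg hc4 hN]
  · have h1 : 1 ≤ c * (n : ℝ) ^ (1 - γ) := by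
      rw [sub_eq_add_neg, Real.rpow_add hn0, Real.rpow_one]
      nlinarith [mul_le_mul_of_nonneg_left hθ hn0.le]
    have h2 := Real.one_le_rpow h1 (by norm_num : (0 : ℝ) ≤ 1 / 4)
    rw [Real.mul_rpow hc.le (by positivity), ← Real.rpow_mul hn0.le] at h2
    have h3 : (n : ℝ) ^ ((3 - γ) / 4) = (n : ℝ) ^ (1 / 2 : ℝ) * (n : ℝ) ^ ((1 - γ) * (1 / 4)) := by
      rw [← Real.rpow_add hn0]; congr 1; ring
    have h4 : 0 ≤ (n : ℝ) ^ (1 / 2 : ℝ) := by positivity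
    have h5 := mul_le_mul_of_nonneg_left h2 h4
    calc (n : ℝ) ^ (1 / 2 : ℝ)
        ≤ (n : ℝ) ^ (1 / 2 : ℝ) * (c ^ (1 / 4 : ℝ) * (n : ℝ) ^ ((1 - γ) * (1 / 4))) := by linarith
      _ = c ^ (1 / 4 : ℝ) * (n : ℝ) ^ ((3 - γ) / 4) := by rw [h3]; ring
      _ ≤ _ := by nlinarith

lemma theta_rpow_mul_le {n : ℕ} (hn : 0 < n) {θ c γ : ℝ} (hθ0 : 0 ≤ θ) (hc : 0 < c)
    (hθ : θ ≤ c * (n : ℝ) ^ (-γ)) :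
    θ ^ (1 / 4 : ℝ) * (n : ℝ) ^ (3 / 4 : ℝ) ≤ c ^ (1 / 4 : ℝ) * (n : ℝ) ^ ((3 - γ) / 4) := by
  have hn0 : (0 : ℝ) < n := by exact_mod_cast hn
  have h := Real.rpow_le_rpow hθ0 hθ (by norm_num : (0 : ℝ) ≤ 1 / 4)
  rw [Real.mul_rpow hc.le (by positivity), ← Real.rpow_mul hn0.le] at h
  have e : (n : ℝ) ^ ((3 - γ) / 4) = (n : ℝ) ^ (-γ * (1 / 4)) * (n : ℝ) ^ (3 / 4 : ℝ) := by
    rw [← Real.rpow_add hn0]; congr 1; ring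
  rw [e, ← mul_assoc]
  gcongr

end Rates

end StrategicClassification

/-! ### The three regimes -/

open scoped ENNReal in
open StrategicClassification in
theorem mainTheorem6 (R₁ R₂ ε r s : ℝ) (hR₁ : 0 < R₁) (hR₂ : 0 < R₂) (hε : 0 < ε)
    (hrs : r.HolderConjugate s) :
    -- no strategic agents
    (∃ C : ℝ, ∀ (p q : ℝ≥0∞) (d n : ℕ) (P : Interaction d n),
      p.HolderConjugate q → 0 < d → 0 < n → P.Admissible R₁ R₂ ε r p → P.theta = 0 →
        P.ExpectedRegretLE (lossBound R₁ R₂ s 0) (lossLip R₁ R₂ s 0) R₂ (C * √n) ∧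
        P.ExpectedRegretLE (lossBound R₁ R₂ s (costFactor ε s q d))
          (lossLip R₁ R₂ s (costFactor ε s q d)) R₂ (C * (d : ℝ) ^ dimExponent s q * √n) ∧
        (p ≤ 2 → P.ExpectedRegretLE (lossBound R₁ R₂ s (costFactor ε s q d))
          (lossLip R₁ R₂ s (costFactor ε s q d)) R₂ (C * √n))) ∧
    -- a constant fraction of strategic agents
    (∀ c : ℝ, 0 < c → ∃ C : ℝ, ∀ (p q : ℝ≥0∞) (d n : ℕ) (P : Interaction d n),
      p.HolderConjugate q → 0 < d → 0 < n → P.Admissible R₁ R₂ ε r p → c ≤ P.theta →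
      P.delta (lossBound R₁ R₂ s (costFactor ε s q d))
        (lossLip R₁ R₂ s (costFactor ε s q d)) R₂ ≤ 1 →
        P.ExpectedRegretLE (lossBound R₁ R₂ s (costFactor ε s q d))
          (lossLip R₁ R₂ s (costFactor ε s q d)) R₂
          (C * ((n : ℝ) ^ (3 / 4 : ℝ) * (d : ℝ) ^ (dimExponent s q + 1 / 2))) ∧
        (p ≤ 2 → P.ExpectedRegretLE (lossBound R₁ R₂ s (costFactor ε s q d))
          (lossLip R₁ R₂ s (costFactor ε s q d)) R₂ (C * (√d * (n : ℝ) ^ (3 / 4 : ℝ))))) ∧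
    -- a polynomially small fraction of strategic agents
    (∀ c γ : ℝ, 0 < c → 0 ≤ γ → ∃ C : ℝ, ∀ (p q : ℝ≥0∞) (d n : ℕ) (P : Interaction d n),
      p.HolderConjugate q → 0 < d → 0 < n → P.Admissible R₁ R₂ ε r p →
      P.theta ≤ c * (n : ℝ) ^ (-γ) → (γ ≤ 1 ∨ 0 < P.theta) →
      P.delta (lossBound R₁ R₂ s (costFactor ε s q d))
        (lossLip R₁ R₂ s (costFactor ε s q d)) R₂ ≤ 1 →
        P.ExpectedRegretLE (lossBound R₁ R₂ s (costFactor ε s q d))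
          (lossLip R₁ R₂ s (costFactor ε s q d)) R₂
          (C * ((n : ℝ) ^ ((3 - γ) / 4) * (d : ℝ) ^ (dimExponent s q + 1 / 2))) ∧
        (p ≤ 2 → P.ExpectedRegretLE (lossBound R₁ R₂ s (costFactor ε s q d))
          (lossLip R₁ R₂ s (costFactor ε s q d)) R₂
          (C * (√d * (n : ℝ) ^ (1 - (1 + γ) / 4))))) := by
  have hs : 0 < s := hrs.symm.pos
  refine ⟨⟨gradientConst R₁ R₂ ε s, fun p q d n P hpq hd hn hP hθ => ?_⟩, fun c hc =>
    ⟨banditConst R₁ R₂ ε s * 1 + gradientConst R₁ R₂ ε s * 1,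
      fun p q d n P hpq hd hn hP _ hδ => ?_⟩, fun c γ hc hγ =>
    ⟨banditConst R₁ R₂ ε s * c ^ (1 / 4 : ℝ) + gradientConst R₁ R₂ ε s * (1 + c ^ (1 / 4 : ℝ)),
      fun p q d n P hpq hd hn hP hθ hor hδ => ?_⟩⟩
  · have hκ₀ : 0 ≤ ε ^ (-s) := by positivity
    have hd1 : (1 : ℝ) ≤ d := by exact_mod_cast hd
    have hmain : P.ExpectedRegretLE (lossBound R₁ R₂ s (costFactor ε s q d))
        (lossLip R₁ R₂ s (costFactor ε s q d)) R₂
        (gradientConst R₁ R₂ ε s * (d : ℝ) ^ dimExponent s q * √n) := by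
      refine (hP.expectedRegretLE_of_theta_eq_zero hrs hε hd hn hpq hR₁ hR₂
        (costFactor_nonneg hε q d) hθ).mono ?_
      have h := lossLip_mul_le (R₂ := R₂) (s := s) (κ := ε ^ (-s)) hR₁
        (Real.one_le_rpow hd1 (dimExponent_nonneg s q))
      have h' := mul_le_mul_of_nonneg_left h (by positivity : 0 ≤ 5 / 2 * R₂ * √n)
      rw [gradientConst, costFactor]
      linarith
    refine ⟨(hP.expectedRegretLE_of_theta_eq_zero hrs hε hd hn hpq hR₁ hR₂ le_rfl hθ).mono ?_,
      hmain, fun hp => ?_⟩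
    -- The Lipschitz constant increases with `κ`, so the constant for `κ = ε ^ (-s)` also serves `κ
    -- = 0`.
    · rw [gradientConst]
      gcongr
      rw [lossLip, lossLip]
      gcongr
    · simpa [dimExponent_eq_zero hs hpq hp] using hmain
  · have hn1 : (1 : ℝ) ≤ n := by exact_mod_cast hn
    have hmain := hP.expectedRegretLE_of_rate hrs hε hd hn hpq hR₁ hR₂ hδ
      (c₁ := 1) (c₂ := 1) (N := (n : ℝ) ^ (3 / 4 : ℝ))
      (mul_le_mul_of_nonneg_right (Real.rpow_le_one P.theta_nonneg P.theta_le_one (by norm_num))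
        (by positivity))
      (by
        rw [one_mul, Real.sqrt_eq_rpow]
        exact Real.rpow_le_rpow_of_exponent_le hn1 (by norm_num))
    refine ⟨hmain, fun hp => ?_⟩
    rw [dimExponent_eq_zero hs hpq hp, zero_add, ← Real.sqrt_eq_rpow, mul_comm _ √(d : ℝ)] at hmain
    exact hmain
  · have hmain := hP.expectedRegretLE_of_rate hrs hε hd hn hpq hR₁ hR₂ hδ
      (theta_rpow_mul_le hn P.theta_nonneg hc hθ)
      (sqrt_natCast_le_rpow hn hc hθ (hor.imp_right fun h => by
        obtain ⟨t, ht⟩ := P.exists_label_neg h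
        exact P.one_le_natCast_mul_theta hn ht))
    refine ⟨hmain, fun hp => ?_⟩
    rw [dimExponent_eq_zero hs hpq hp, zero_add, ← Real.sqrt_eq_rpow, mul_comm _ √(d : ℝ),
      show (3 - γ) / 4 = 1 - (1 + γ) / 4 by ring] at hmain
    exact hmain
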